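/- Let $\mathbb R^{4,2}=\mathbb R^{1,1}\oplus\mathbb R^{3,1}$, let $(\mathfrak p,\mathfrak q)$ be an orthonormal basis of $\mathbb R^{1,1}$ with $|\mathfrak p|^2=-1$, $|\mathfrak q|^2=1$, and put $q^\pm=\mathfrak p\pm\mathfrak q$. Identify $a\wedge b$ with the skew endomorphism $y\mapsto (a,y)b-(b,y)a$. Let $U\subset\mathbb R^2$ be a domain and let $\mathfrak f:U\to H^3=\{y\in\mathbb R^{3,1}: |y|^2=-1,\ y_0>0\}$ be a smooth flat front with unit normal field $\mathfrak t$ (so $(\mathfrak f,\mathfrak t)$ is an immersion, and $\kappa_1\kappa_2=1$, suitably interpreted at singularities of $\mathfrak f$), free of umbilics and parametrized by curvature line coordinates $(u,v)$ with $\kappa_1=\tanh\varphi$, $\kappa_2=\coth\varphi$, $\varphi$ smooth, i.e. $\cosh\varphi\,\mathfrak t_u+\sinh\varphi\,\mathfrak f_u=0=\sinh\varphi\,\mathfrak t_v+\cosh\varphi\,\mathfrak f_v$. Let $f=\mathrm{span}\{\mathfrak q+\mathfrak f,\mathfrak p+\mathfrak t\}$ be its Legendre lift and $$s_1=\cosh\varphi(\mathfrak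 p+\mathfrak t)+\sinh\varphi(\mathfrak q+\mathfrak f),\quad s_2=\sinh\varphi(\mathfrak p+\mathfrak t)+\cosh\varphi(\mathfrak q+\mathfrak f),\quad s^\pm=s_1\pm s_2 .$$ Then $s_1,s_2$ are lifts of the curvature spheres ($s_2\wedge s_{1u}=s_1\wedge s_{2v}=0$) spanning $f$, and $s^\pm$ are Moutard lifts ($s^\pm\wedge s^\pm_{uv}=0$), so that $f$ is an $\Omega$-surface. For $\lambda\in\mathbb R$ a Lie geometric deformation of $f$ with parameter $\lambda$ is given by $T:U\to \mathrm{End}(\mathbb R^{4,2})$, $$T=T^+\bigl(1+\tfrac\lambda2 s^+\wedge s^-\bigr)=T^-\bigl(1+\tfrac\lambda2 s^-\wedge s^+\bigr),$$ where $T^\pm:U\to O(4,2)$ are smooth with $dT^\pm=T^\pm\lambda\,s^\pm\wedge\star ds^\pm$, $\star du=du$, $\star dv=-dv$. Put $p^\pm=q^\pm+\frac\lambda2(q^\pm,s^\mp)s^\pm$. The hyperbolic Gauss maps of a front $(\mathfrak f,\mathfrak t)$ are the maps $[\mathfrak t\pm\mathfrak f]$ into $S^2$, the set of null lines of $\mathbb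 R^{3,1}$; together they form a map into the symmetric space of point pairs in $S^2$. For $\mathbb K\in\{\mathbb R,\mathbb C\}$, a $\mathbb K$-adapted frame of a point-pair map is a smooth frame $F=(e_1,e_2,h^+,h^-)$ of $\mathbb K^4=\mathbb R^{3,1}\otimes\mathbb K$ with $h^+,h^-$ in the ($\mathbb K$-spans of the) two null lines, $e_1,e_2$ orthonormal and orthogonal to $h^\pm$, and $(h^+,h^-)=2$. Split $\Phi=F^{-1}dF=\Phi_{\mathfrak k}+\Phi_{\mathfrak p}$ into the part preserving $\mathrm{span}\{e_1,e_2\}$ and $\mathrm{span}\{h^+,h^-\}$ and the part interchanging them. The point-pair map is a curved flat (a degenerate Darboux pair) if, for a real adapted frame, $[\Phi_{\mathfrak p}(X),\Phi_{\mathfrak p}(Y)]=0$ for all $X,Y$ and $\Phi_{\mathfrak p}$ is injective at each point. A point-pair map $G'$ belongs to the curved flat associated family of $G$ with parameter $\mu\in\mathbb K$ if there are a real adapted frame $F$ of $G$ and a $\mathbb K$-adapted frame $F'$ of $G'$ with $F'^{-1}dF'=\Phi_{\mathfrak k}+\mu\Phi_{\mathfrak p}$, $\Phi=F^{-1}dF$.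 **Theorem.** The pair of hyperbolic Gauss maps of $\mathfrak f$ is a curved flat. Let $\lambda\in\mathbb R$, $\lambda\neq\frac12$, and let $T$ be a Lie geometric deformation of $f$ with parameter $\lambda$. Then: 1. The constants of integration can be chosen so that the deformed surface is a flat front in $H^3$: there is $A\in O(4,2)$ such that $ATp^\pm\in\mathbb R q^\pm$ on $U$ and $ATf$ is the Legendre lift of a flat front in $H^3$. 2. For every $A\in O(4,2)$ with $ATp^\pm\in\mathbb R q^\pm$ on $U$, there are $\mathfrak f',\mathfrak t':U\to\mathbb R^{3,1}$ with $ATf=\mathrm{span}\{\mathfrak q+\mathfrak f',\mathfrak p+\mathfrak t'\}$, such that $(\mathfrak f',\mathfrak t')$ or $(-\mathfrak f',-\mathfrak t')$ is a flat front in $H^3$ with its unit normal field, and the pair of hyperbolic Gauss maps of $(\mathfrak f',\mathfrak t')$ is a curved flat that belongs to the curved flat associated family of the pair of hyperbolic Gauss maps of $\mathfrak f$ with parameter $\sqrt{1-2\lambda}$, for either choice of the square root: with complex frames for every $\lambda\ne\frac12$ (the parameter is imaginary for $\lambda>\frac12$), and with real frames if $\lambda<\frac12$. -/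

import Mathlib

open scoped ContDiff

/-! ## The spaces `ℝ^{3,1}` and `ℝ^{4,2} = ℝ^{1,1} ⊕ ℝ^{3,1}` -/

/-- The Minkowski product `-x₀y₀ + x₁y₁ + x₂y₂ + x₃y₃` (bilinear, also over `ℂ`). -/
def mink {R : Type*} [CommRing R] (x y : Fin 4 → R) : R :=
  -(x 0 * y 0) + x 1 * y 1 + x 2 * y 2 + x 3 * y 3

/-- Minkowski space `ℝ^{3,1}`. -/
abbrev R31 : Type := Fin 4 → ℝ

/-- The space `ℝ^{4,2}` of Lie sphere geometry, split as `ℝ^{1,1} ⊕ ℝ^{3,1}`. -/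
abbrev R42 : Type := (ℝ × ℝ) × R31

/-- The inner product of signature `(4,2)`. -/
def lieForm (x y : R42) : ℝ :=
  -(x.1.1 * y.1.1) + x.1.2 * y.1.2 + mink x.2 y.2

/-- The linear functional `y ↦ (x, y)` on `ℝ^{4,2}`. -/
noncomputable def lieDual (x : R42) : R42 →L[ℝ] ℝ :=
  LinearMap.toContinuousLinearMap
    { toFun := fun y => lieForm x y
      map_add' := by intro y z; simp [lieForm, mink]; ring
      map_smul' := by intro c y; simp [lieForm, mink]; ring }

/-- The skew endomorphism `a ∧ b`, `(a ∧ b) y = (a, y) b - (b, y) a`. -/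
noncomputable def wedge (a b : R42) : R42 →L[ℝ] R42 :=
  (lieDual a).smulRight b - (lieDual b).smulRight a

/-- Membership of the orthogonal group `O(4,2)`. -/
def IsLieIsometry (A : R42 →L[ℝ] R42) : Prop :=
  ∀ x y, lieForm (A x) (A y) = lieForm x y

/-- The inclusion of `ℝ^{3,1}` as the orthogonal complement of `ℝ^{1,1}`. -/
def incl (y : R31) : R42 := ((0, 0), y)

/-- The point sphere complex `𝔭`, `|𝔭|² = -1`. -/
def pVec : R42 := ((1, 0), 0)

/-- The unit vector `𝔮` with `|𝔮|² = 1`, orthogonal to `𝔭`. -/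
def qVec : R42 := ((0, 1), 0)

/-- The infinity sphere `q⁺ = 𝔭 + 𝔮` of hyperbolic space. -/
def qPlus : R42 := pVec + qVec

/-- The infinity sphere with the opposite orientation, `q⁻ = 𝔭 - 𝔮`. -/
def qMinus : R42 := pVec - qVec

/-! ## Flat fronts in hyperbolic space

Surfaces are parametrized over open sets of the `(u,v)`-plane `ℝ × ℝ`. -/

/-- `∂s/∂u`. -/
noncomputable def dU {E : Type*} [NormedAddCommGroup E] [NormedSpace ℝ E]
    (s : ℝ × ℝ → E) (x : ℝ × ℝ) : E := fderiv ℝ s x (1, 0)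

/-- `∂s/∂v`. -/
noncomputable def dV {E : Type*} [NormedAddCommGroup E] [NormedSpace ℝ E]
    (s : ℝ × ℝ → E) (x : ℝ × ℝ) : E := fderiv ℝ s x (0, 1)

/-- `f` is a flat front in `H³ = {y | |y|² = -1, y₀ > 0}` with unit normal field `t`. -/
structure IsFlatFront (U : Set (ℝ × ℝ)) (f t : ℝ × ℝ → R31) : Prop where
  smooth_f : ContDiffOn ℝ ∞ f U
  smooth_t : ContDiffOn ℝ ∞ t U
  norm_f : ∀ x ∈ U, mink (f x) (f x) = -1
  pos_f : ∀ x ∈ U, 0 < f x 0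
  norm_t : ∀ x ∈ U, mink (t x) (t x) = 1
  orth : ∀ x ∈ U, mink (f x) (t x) = 0
  normal : ∀ x ∈ U, ∀ w, mink (fderiv ℝ f x w) (t x) = 0
  /-- The Legendre lift is regular: `(f, t)` is an immersion. -/
  immersed : ∀ x ∈ U, ∀ w, fderiv ℝ f x w = 0 → fderiv ℝ t x w = 0 → w = 0
  /-- Where `f` immerses, `dt = -df ∘ S` with `det S = κ₁κ₂`, so this says `κ₁κ₂ = 1`, that is,
  the Gauss curvature `-1 + κ₁κ₂` vanishes. In this form the condition is invariant under passing
  to parallel fronts and so also makes sense at the singularities of `f`. -/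
  flat : ∀ x ∈ U, Matrix.det (Matrix.of ![f x, t x, dU f x, dV f x]) =
    Matrix.det (Matrix.of ![f x, t x, dU t x, dV t x])

/-- `(u,v)` are curvature line coordinates with principal curvatures `κ₁ = tanh φ` and
`κ₂ = coth φ`: `0 = t_u + tanh φ f_u = t_v + coth φ f_v`, with denominators cleared so that
singularities (`φ = 0`) are allowed. -/
structure IsCurvatureLineParam (U : Set (ℝ × ℝ)) (f t : ℝ × ℝ → R31) (φ : ℝ × ℝ → ℝ) :
    Prop where
  smooth : ContDiffOn ℝ ∞ φ U
  eq_u : ∀ x ∈ U, Real.cosh (φ x) • dU t x + Real.sinh (φ x) • dU f x = 0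
  eq_v : ∀ x ∈ U, Real.sinh (φ x) • dV t x + Real.cosh (φ x) • dV f x = 0

/-- The Legendre lift: the contact element `span {𝔮 + f, 𝔭 + t}`. -/
def legendreLift (f t : ℝ × ℝ → R31) (x : ℝ × ℝ) : Submodule ℝ R42 :=
  Submodule.span ℝ {qVec + incl (f x), pVec + incl (t x)}

/-- The lift `s₁ = cosh φ (𝔭 + t) + sinh φ (𝔮 + f)` of the first curvature sphere. -/
noncomputable def curvSphere₁ (f t : ℝ × ℝ → R31) (φ : ℝ × ℝ → ℝ) (x : ℝ × ℝ) : R42 :=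
  Real.cosh (φ x) • (pVec + incl (t x)) + Real.sinh (φ x) • (qVec + incl (f x))

/-- The lift `s₂ = sinh φ (𝔭 + t) + cosh φ (𝔮 + f)` of the second curvature sphere. -/
noncomputable def curvSphere₂ (f t : ℝ × ℝ → R31) (φ : ℝ × ℝ → ℝ) (x : ℝ × ℝ) : R42 :=
  Real.sinh (φ x) • (pVec + incl (t x)) + Real.cosh (φ x) • (qVec + incl (f x))

/-! ## Ω-surfaces, Calapso transformations and the Lie geometric deformation -/

/-- A Moutard lift of an isothermic sphere congruence: `s ∧ s_uv = 0`. -/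
def IsMoutardLift (U : Set (ℝ × ℝ)) (s : ℝ × ℝ → R42) : Prop :=
  ContDiffOn ℝ ∞ s U ∧ ∀ x ∈ U, wedge (s x) (dV (dU s) x) = 0

/-- `s₁`, `s₂` are lifts of the curvature spheres (along `u` and `v`) of the Legendre map `L`,
and `s^± = s₁ ± s₂` are Moutard lifts of isothermic sphere congruences enveloped by `L`
(which then separate the curvature spheres harmonically). -/
structure IsOmegaSurface (U : Set (ℝ × ℝ)) (L : ℝ × ℝ → Submodule ℝ R42)
    (s₁ s₂ : ℝ × ℝ → R42) : Prop where
  span_eq : ∀ x ∈ U, Submodule.span ℝ {s₁ x, s₂ x} = L x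
  curv₁ : ∀ x ∈ U, wedge (s₂ x) (dU s₁ x) = 0
  curv₂ : ∀ x ∈ U, wedge (s₁ x) (dV s₂ x) = 0
  moutard_plus : IsMoutardLift U (s₁ + s₂)
  moutard_minus : IsMoutardLift U (s₁ - s₂)

/-- The 1-form `τ = s ∧ ⋆ds`, where `⋆du = du` and `⋆dv = -dv`. -/
noncomputable def calapsoForm (s : ℝ × ℝ → R42) (x w : ℝ × ℝ) : R42 →L[ℝ] R42 :=
  wedge (s x) (fderiv ℝ s x (w.1, -w.2))

/-- `T : U → O(4,2)` is a Calapso transformation with parameter `lam` for the Moutard lift `s`: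
`dT = T lam τ`. -/
structure IsCalapso (U : Set (ℝ × ℝ)) (s : ℝ × ℝ → R42) (lam : ℝ)
    (T : ℝ × ℝ → R42 →L[ℝ] R42) : Prop where
  smooth : ContDiffOn ℝ ∞ T U
  isometry : ∀ x ∈ U, IsLieIsometry (T x)
  deriv_eq : ∀ x ∈ U, ∀ w, fderiv ℝ T x w = (T x).comp (lam • calapsoForm s x w)

/-- `T` is the Lie geometric deformation with parameter `lam` of the Ω-surface
`span {s₁, s₂}`: with `s^± = s₁ ± s₂` and Calapso transformations `T^±` of `s^±`,
`T = T⁺ (1 + (lam/2) s⁺ ∧ s⁻) = T⁻ (1 + (lam/2) s⁻ ∧ s⁺)`. -/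
def IsLieDeformation (U : Set (ℝ × ℝ)) (s₁ s₂ : ℝ × ℝ → R42) (lam : ℝ)
    (T : ℝ × ℝ → R42 →L[ℝ] R42) : Prop :=
  ∃ Tp Tm : ℝ × ℝ → R42 →L[ℝ] R42,
    IsCalapso U (s₁ + s₂) lam Tp ∧ IsCalapso U (s₁ - s₂) lam Tm ∧
    ∀ x ∈ U,
      T x = (Tp x).comp (ContinuousLinearMap.id ℝ R42
        + (lam / 2) • wedge (s₁ x + s₂ x) (s₁ x - s₂ x)) ∧
      T x = (Tm x).comp (ContinuousLinearMap.id ℝ R42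
        + (lam / 2) • wedge (s₁ x - s₂ x) (s₁ x + s₂ x))

/-- The conserved quantity `p⁺ = q⁺ + (lam/2) (q⁺, s⁻) s⁺`. -/
noncomputable def pPlus (s₁ s₂ : ℝ × ℝ → R42) (lam : ℝ) (x : ℝ × ℝ) : R42 :=
  qPlus + (lam / 2 * lieForm qPlus (s₁ x - s₂ x)) • (s₁ x + s₂ x)

/-- The conserved quantity `p⁻ = q⁻ + (lam/2) (q⁻, s⁺) s⁻`. -/
noncomputable def pMinus (s₁ s₂ : ℝ × ℝ → R42) (lam : ℝ) (x : ℝ × ℝ) : R42 :=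
  qMinus + (lam / 2 * lieForm qMinus (s₁ x + s₂ x)) • (s₁ x - s₂ x)

/-- The constants of integration are chosen so that `T p^± ∥ q^±`. -/
def IsNormalized (U : Set (ℝ × ℝ)) (s₁ s₂ : ℝ × ℝ → R42) (lam : ℝ)
    (T : ℝ × ℝ → R42 →L[ℝ] R42) : Prop :=
  ∀ x ∈ U, T x (pPlus s₁ s₂ lam x) ∈ Submodule.span ℝ {qPlus} ∧
    T x (pMinus s₁ s₂ lam x) ∈ Submodule.span ℝ {qMinus}

/-- `T` maps the contact elements of the front `(f, t)` to those of the front `(f', t')`. -/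
def MapsFront (U : Set (ℝ × ℝ)) (T : ℝ × ℝ → R42 →L[ℝ] R42) (f t f' t' : ℝ × ℝ → R31) :
    Prop :=
  ∀ x ∈ U, (legendreLift f t x).map (T x).toLinearMap = legendreLift f' t' x

/-! ## Curved flats in the symmetric space of point pairs in `S²`

A point of the conformal 2-sphere is a null line in `ℝ^{3,1}`. -/

/-- The pair of hyperbolic Gauss maps `[t + f]`, `[t - f]` of a front. -/
def gaussPair (f t : ℝ × ℝ → R31) (x : ℝ × ℝ) : Submodule ℝ R31 × Submodule ℝ R31 :=
  (Submodule.span ℝ {t x + f x}, Submodule.span ℝ {t x - f x})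

/-- The Gram matrix of adapted frames `(e₁, e₂, h⁺, h⁻)`. -/
def frameGram (𝕜 : Type*) [RCLike 𝕜] : Matrix (Fin 4) (Fin 4) 𝕜 :=
  !![1, 0, 0, 0; 0, 1, 0, 0; 0, 0, 0, 2; 0, 0, 2, 0]

/-- `F = (e₁, e₂, h⁺, h⁻)` is a smooth frame adapted to the map `G` into the space of point
pairs: `h⁺` and `h⁻` lie on the (for `𝕜 = ℂ`: complexified) two null lines. -/
structure IsAdaptedFrame (𝕜 : Type*) [RCLike 𝕜] (U : Set (ℝ × ℝ))
    (G : ℝ × ℝ → Submodule ℝ R31 × Submodule ℝ R31)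
    (F : ℝ × ℝ → Fin 4 → (Fin 4 → 𝕜)) : Prop where
  smooth : ContDiffOn ℝ ∞ F U
  gram : ∀ x ∈ U, ∀ i j, mink (F x i) (F x j) = frameGram 𝕜 i j
  plus : ∀ x ∈ U, ∃ y ∈ (G x).1, ∃ c : 𝕜, F x 2 = c • fun k => algebraMap ℝ 𝕜 (y k)
  minus : ∀ x ∈ U, ∃ y ∈ (G x).2, ∃ c : 𝕜, F x 3 = c • fun k => algebraMap ℝ 𝕜 (y k)

/-- `Φ = F⁻¹ dF`. -/
def IsConnectionForm {𝕜 : Type*} [RCLike 𝕜] (U : Set (ℝ × ℝ))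
    (F : ℝ × ℝ → Fin 4 → (Fin 4 → 𝕜)) (Φ : ℝ × ℝ → ℝ × ℝ → Matrix (Fin 4) (Fin 4) 𝕜) : Prop :=
  ∀ x ∈ U, ∀ w j, fderiv ℝ (fun z => F z j) x w = ∑ i, Φ x w i j • F x i

/-- The component in the isotropy algebra `𝔨` (block diagonal part for the splitting
`{e₁, e₂} ⊕ {h⁺, h⁻}`). -/
def kPart (M : Matrix (Fin 4) (Fin 4) ℝ) : Matrix (Fin 4) (Fin 4) ℝ :=
  Matrix.of fun i j => if (i < 2 ↔ j < 2) then M i j else 0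

/-- The component in the complement `𝔭` of the symmetric decomposition. -/
def pPart (M : Matrix (Fin 4) (Fin 4) ℝ) : Matrix (Fin 4) (Fin 4) ℝ :=
  Matrix.of fun i j => if (i < 2 ↔ j < 2) then 0 else M i j

/-- The point pair map `G` is an (immersed) curved flat: `[Φ_𝔭 ∧ Φ_𝔭] = 0`. This is the notion
of a (degenerate) Darboux pair in `S²`. -/
def IsCurvedFlat (U : Set (ℝ × ℝ)) (G : ℝ × ℝ → Submodule ℝ R31 × Submodule ℝ R31) : Prop :=
  ∃ (F : ℝ × ℝ → Fin 4 → R31) (Φ : ℝ × ℝ → ℝ × ℝ → Matrix (Fin 4) (Fin 4) ℝ),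
    IsAdaptedFrame ℝ U G F ∧ IsConnectionForm U F Φ ∧
    ∀ x ∈ U, (∀ w w', Commute (pPart (Φ x w)) (pPart (Φ x w'))) ∧
      ∀ w, pPart (Φ x w) = 0 → w = 0

/-- `G'` is a member with parameter `μ` of the curved flat associated family of `G`: it is framed
by a solution `F'` of `F'⁻¹ dF' = Φ_𝔨 + μ Φ_𝔭`, where `Φ = F⁻¹ dF` for an adapted frame `F` of `G`.
The choice of `F` is immaterial, by gauging both frames simultaneously. -/
def IsAssociatedCurvedFlat (𝕜 : Type*) [RCLike 𝕜] (U : Set (ℝ × ℝ)) (μ : 𝕜)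
    (G G' : ℝ × ℝ → Submodule ℝ R31 × Submodule ℝ R31) : Prop :=
  ∃ (F : ℝ × ℝ → Fin 4 → R31) (Φ : ℝ × ℝ → ℝ × ℝ → Matrix (Fin 4) (Fin 4) ℝ)
    (F' : ℝ × ℝ → Fin 4 → (Fin 4 → 𝕜)),
    IsAdaptedFrame ℝ U G F ∧ IsConnectionForm U F Φ ∧ IsAdaptedFrame 𝕜 U G' F' ∧
    IsConnectionForm U F' fun x w =>
      (kPart (Φ x w)).map (algebraMap ℝ 𝕜) + μ • (pPart (Φ x w)).map (algebraMap ℝ 𝕜)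

/-! Let `e₁`, `e₂` be the unit principal directions and `g = t + f`, `h = t - f` null lifts of the
Gauss maps, so `(g, h) = 2`. In curvature line coordinates the front equations become `dg = e^{-φ}
(α e₁ du + β e₂ dv)` and `dh = e^{φ} (-α e₁ du + β e₂ dv)`; this is the content of `IsNullFrame` and
`IsFlatFront.exists_isNullFrame`. The isotropy part of the connection of `(e₁, e₂, g, h)` is the
rotation form `θ` alone, and the values of its other part commute, which is the curved flat
condition (`IsNullFrame.isCurvedFlat`). Conversely such a frame yields a flat front once `(g - h) /
2` lies on the upper sheet (`IsNullFrame.isFlatFront`).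

The Moutard lifts are `s⁺ = e^{φ} (q⁺ + g)` and `s⁻ = e^{-φ} (q⁻ + h)`. Gauging the Calapso form of
`s⁺` by `1 + (λ/2) s⁺ ∧ s⁻` removes `dφ` and leaves `T⁻¹ dT = ω = λ (α s₂ ∧ e₁ du - β s₁ ∧ e₂ dv)`
(`isDeformation_of_isLieDeformation`). The form `ω` annihilates the contact elements and sends `q⁺`
to `λ dg` and `q⁻` to `λ dh`. Since `p⁺ = q⁺ - λ (q⁺ + g)` and `p⁻ = q⁻ - λ (q⁻ + h)`, both `T p^±`
are constant. They are null with product `-2 (1 - 2λ)`, so for `λ ≠ 1/2` a constant isometry moves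
them to multiples of `q^±` (`exists_isLieIsometry_null_pair`).

Suppose `T p⁺ = d q⁺` and `T p⁻ = c q⁻`, which forces `c d = 1 - 2λ`. Then `T e₁`, `T e₂` lie in
`ℝ^{3,1}`, while `c T (q⁺ + g) = q⁺ + g'` and `d T (q⁻ + h) = q⁻ + h'`. The new frame has the same
`α`, `β`, `θ`, with `dg`, `dh` scaled by `c`, `d` (`IsDeformation.exists_isNullFrame`). Rescaling
`g'`, `h'` by `μ / c`, `μ / d` with `μ² = c d` keeps their product equal to `2` and multiplies the
off-diagonal part of the connection by `μ` (`IsNullFrame.isAssociatedCurvedFlat`). When `c d < 0`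
this rescaling is complex. Connectedness of `U` puts the new surface on one sheet of the
hyperboloid, and `-1` on `ℝ^{3,1}` exchanges the sheets. -/

/-! ## Algebra of the two inner products -/

section Mink
variable {R : Type*} [CommRing R] (x y z : Fin 4 → R) (c : R)

theorem mink_comm : mink x y = mink y x := by simp only [mink]; ring
theorem mink_add_left : mink (x + y) z = mink x z + mink y z := by
  simp only [mink, Pi.add_apply]; ring
theorem mink_add_right : mink x (y + z) = mink x y + mink x z := by
  simp only [mink, Pi.add_apply]; ring
theorem mink_sub_left : mink (x - y) z = mink x z - mink y z := by
  simp only [mink, Pi.sub_apply]; ring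
theorem mink_sub_right : mink x (y - z) = mink x y - mink x z := by
  simp only [mink, Pi.sub_apply]; ring
theorem mink_smul_left : mink (c • x) y = c * mink x y := by
  simp only [mink, Pi.smul_apply, smul_eq_mul]; ring
theorem mink_smul_right : mink x (c • y) = c * mink x y := by
  simp only [mink, Pi.smul_apply, smul_eq_mul]; ring
theorem mink_neg_left : mink (-x) y = -mink x y := by
  simp only [mink, Pi.neg_apply]; ring
theorem mink_neg_right : mink x (-y) = -mink x y := by
  simp only [mink, Pi.neg_apply]; ring

end Mink

theorem mink_algebraMap {𝕜 : Type*} [RCLike 𝕜] (x y : R31) :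
    mink (fun k => algebraMap ℝ 𝕜 (x k)) (fun k => algebraMap ℝ 𝕜 (y k)) =
      algebraMap ℝ 𝕜 (mink x y) := by
  simp [mink]

/-- A vector orthogonal to a unit timelike vector is spacelike. -/
theorem mink_self_pos_of_orthogonal {f a : R31} (hf : mink f f = -1) (hfa : mink f a = 0)
    (ha : a ≠ 0) : 0 < mink a a := by
  simp only [mink] at *
  have hcs : (f 1 * a 1 + f 2 * a 2 + f 3 * a 3) ^ 2 ≤
      (f 1 ^ 2 + f 2 ^ 2 + f 3 ^ 2) * (a 1 ^ 2 + a 2 ^ 2 + a 3 ^ 2) := by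
    nlinarith [sq_nonneg (f 1 * a 2 - f 2 * a 1), sq_nonneg (f 1 * a 3 - f 3 * a 1),
      sq_nonneg (f 2 * a 3 - f 3 * a 2)]
  have h1 : f 1 * a 1 + f 2 * a 2 + f 3 * a 3 = f 0 * a 0 := by linarith
  have h2 : f 1 ^ 2 + f 2 ^ 2 + f 3 ^ 2 = f 0 ^ 2 - 1 := by nlinarith
  have hf0 : 0 < f 0 ^ 2 := by nlinarith [sq_nonneg (f 1), sq_nonneg (f 2), sq_nonneg (f 3)]
  rw [h1, h2] at hcs
  -- Cauchy-Schwarz now reads `f₀² a₀² ≤ (f₀² - 1) |a|²` for the spatial part of `a`; moving terms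
  -- bounds `|a|²` by `f₀² (a, a)`.
  have h3 : a 1 ^ 2 + a 2 ^ 2 + a 3 ^ 2 ≤
      f 0 ^ 2 * (-(a 0 * a 0) + a 1 * a 1 + a 2 * a 2 + a 3 * a 3) := by nlinarith
  have h4 : 0 < a 1 ^ 2 + a 2 ^ 2 + a 3 ^ 2 := by
    by_contra hn
    have e1 : a 1 = 0 := by nlinarith [sq_nonneg (a 1), sq_nonneg (a 2), sq_nonneg (a 3)]
    have e2 : a 2 = 0 := by nlinarith [sq_nonneg (a 1), sq_nonneg (a 2), sq_nonneg (a 3)]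
    have e3 : a 3 = 0 := by nlinarith [sq_nonneg (a 1), sq_nonneg (a 2), sq_nonneg (a 3)]
    have e0 : a 0 = 0 := by
      have h5 : f 0 * a 0 = 0 := by rw [← h1, e1, e2, e3]; ring
      rcases mul_eq_zero.1 h5 with h | h
      · simp [h] at hf0
      · exact h
    apply ha
    ext i
    fin_cases i <;> assumption
  by_contra hn
  nlinarith

/-- An adapted frame spans `ℝ^{3,1}`. -/
theorem eq_zero_of_mink_frame {e : Fin 4 → R31} (he : ∀ i j, mink (e i) (e j) = frameGram ℝ i j)
    {y : R31} (hy : ∀ i, mink y (e i) = 0) : y = 0 := by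
  let G : Matrix (Fin 4) (Fin 4) ℝ := Matrix.diagonal ![-1, 1, 1, 1]
  let E : Matrix (Fin 4) (Fin 4) ℝ := Matrix.of e
  have hG : ∀ a b : R31, a ⬝ᵥ G.mulVec b = mink a b := by
    intro a b
    simp [G, Matrix.mulVec_diagonal, dotProduct, Fin.sum_univ_four, mink]
  -- The Gram matrix is invertible, hence so is `E * G`, and `E * G` sends `y` to the vector of its
  -- pairings with the frame.
  have hE : E * G * E.transpose = frameGram ℝ := by
    ext i j
    rw [← he, ← hG, Matrix.mul_assoc, Matrix.mul_apply]
    simp only [dotProduct, Matrix.mulVec, Matrix.mul_apply, E, Matrix.transpose_apply,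
      Matrix.of_apply]
  have hdet : (frameGram ℝ).det ≠ 0 := by
    simp [frameGram, Matrix.det_succ_row_zero, Fin.sum_univ_succ, Fin.succAbove]
  have hEG : (E * G).det ≠ 0 := by
    intro h
    rw [← hE, Matrix.det_mul, h, zero_mul] at hdet
    exact hdet rfl
  refine Matrix.eq_zero_of_mulVec_eq_zero hEG ?_
  ext i
  rw [← Matrix.mulVec_mulVec]
  change e i ⬝ᵥ G.mulVec y = 0
  rw [hG, mink_comm, hy]

/-- The null vectors `e 2`, `e 3` are dual to each other up to the factor `2`, so their coefficients
are crossed and halved. -/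
theorem frame_expansion {e : Fin 4 → R31} (he : ∀ i j, mink (e i) (e j) = frameGram ℝ i j)
    (y : R31) : y = mink y (e 0) • e 0 + mink y (e 1) • e 1 + (mink y (e 3) / 2) • e 2 +
      (mink y (e 2) / 2) • e 3 := by
  refine sub_eq_zero.1 (eq_zero_of_mink_frame he fun i => ?_)
  simp only [mink_sub_left, mink_add_left, mink_smul_left, he]
  fin_cases i <;> simp [frameGram]

section Lie
variable (x y z : R42) (c : ℝ)

theorem lieForm_comm : lieForm x y = lieForm y x := by simp only [lieForm, mink]; ring
theorem lieForm_add_left : lieForm (x + y) z = lieForm x z + lieForm y z := by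
  simp [lieForm, mink]; ring
theorem lieForm_add_right : lieForm x (y + z) = lieForm x y + lieForm x z := by
  simp [lieForm, mink]; ring
theorem lieForm_sub_left : lieForm (x - y) z = lieForm x z - lieForm y z := by
  simp [lieForm, mink]; ring
theorem lieForm_sub_right : lieForm x (y - z) = lieForm x y - lieForm x z := by
  simp [lieForm, mink]; ring
theorem lieForm_smul_left : lieForm (c • x) y = c * lieForm x y := by
  simp [lieForm, mink]; ring
theorem lieForm_smul_right : lieForm x (c • y) = c * lieForm x y := by
  simp [lieForm, mink]; ring
theorem lieForm_neg_right : lieForm x (-y) = -lieForm x y := by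
  simp [lieForm, mink]; ring

theorem wedge_apply (a b : R42) : wedge a b y = lieForm a y • b - lieForm b y • a := rfl

theorem lieForm_qPlus : lieForm x qPlus = -x.1.1 + x.1.2 := by
  simp [lieForm, qPlus, pVec, qVec, mink]
theorem lieForm_qMinus : lieForm x qMinus = -x.1.1 - x.1.2 := by
  simp [lieForm, qMinus, pVec, qVec, mink]; ring
@[simp] theorem lieForm_incl (a b : R31) : lieForm (incl a) (incl b) = mink a b := by
  simp [lieForm, incl]

end Lie

/-- The inclusion `ℝ^{3,1} → ℝ^{4,2}` as a continuous linear map. -/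
noncomputable def inclL : R31 →L[ℝ] R42 := ContinuousLinearMap.inr ℝ (ℝ × ℝ) R31

theorem inclL_apply (y : R31) : inclL y = incl y := rfl

/-- The wedge product as a bilinear map. -/
noncomputable def wedgeBilin : R42 →ₗ[ℝ] R42 →ₗ[ℝ] (R42 →L[ℝ] R42) :=
  LinearMap.mk₂ ℝ wedge
    (by intros; refine ContinuousLinearMap.ext fun y => ?_
        simp only [wedge_apply, add_apply, lieForm_add_left]; module)
    (by intros; refine ContinuousLinearMap.ext fun y => ?_
        simp only [wedge_apply, smul_apply, lieForm_smul_left]; module)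
    (by intros; refine ContinuousLinearMap.ext fun y => ?_
        simp only [wedge_apply, add_apply, lieForm_add_left]; module)
    (by intros; refine ContinuousLinearMap.ext fun y => ?_
        simp only [wedge_apply, smul_apply, lieForm_smul_left]; module)

/-- The wedge product as a continuous bilinear map. -/
noncomputable def wedgeL : R42 →L[ℝ] R42 →L[ℝ] (R42 →L[ℝ] R42) :=
  wedgeBilin.toContinuousBilinearMap

theorem wedgeL_apply (a b : R42) : wedgeL a b = wedge a b := rfl

/-! ## Calculus -/

theorem ContDiffOn.differentiableAt_of_isOpen {E : Type*} [NormedAddCommGroup E] [NormedSpace ℝ E]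
    {U : Set (ℝ × ℝ)} (hU : IsOpen U) {s : ℝ × ℝ → E} (hs : ContDiffOn ℝ ∞ s U)
    {x : ℝ × ℝ} (hx : x ∈ U) : DifferentiableAt ℝ s x :=
  (hs.contDiffAt (hU.mem_nhds hx)).differentiableAt (by simp)

theorem fderiv_congr_of_isOpen {E : Type*} [NormedAddCommGroup E] [NormedSpace ℝ E]
    {U : Set (ℝ × ℝ)} (hU : IsOpen U) {s r : ℝ × ℝ → E} (h : ∀ x ∈ U, s x = r x)
    {x : ℝ × ℝ} (hx : x ∈ U) : fderiv ℝ s x = fderiv ℝ r x :=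
  Filter.EventuallyEq.fderiv_eq (Filter.eventuallyEq_of_mem (hU.mem_nhds hx) h)

theorem fderiv_eq_dU_dV {E : Type*} [NormedAddCommGroup E] [NormedSpace ℝ E] (s : ℝ × ℝ → E)
    (x w : ℝ × ℝ) : fderiv ℝ s x w = w.1 • dU s x + w.2 • dV s x := by
  rw [dU, dV, ← map_smul, ← map_smul, ← map_add]
  simp

theorem ContDiffOn.fderiv_apply_of_isOpen {E : Type*} [NormedAddCommGroup E] [NormedSpace ℝ E]
    {U : Set (ℝ × ℝ)} (hU : IsOpen U) {s : ℝ × ℝ → E} (hs : ContDiffOn ℝ ∞ s U) (w : ℝ × ℝ) :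
    ContDiffOn ℝ ∞ (fun x => fderiv ℝ s x w) U :=
  (hs.fderiv_of_isOpen hU (m := ∞) (by simp)).clm_apply contDiffOn_const

theorem dV_dU_comm {E : Type*} [NormedAddCommGroup E] [NormedSpace ℝ E]
    {U : Set (ℝ × ℝ)} (hU : IsOpen U) {s : ℝ × ℝ → E} (hs : ContDiffOn ℝ ∞ s U)
    {x : ℝ × ℝ} (hx : x ∈ U) : dV (dU s) x = dU (dV s) x := by
  have hd : DifferentiableAt ℝ (fderiv ℝ s) x :=
    (hs.fderiv_of_isOpen hU (m := ∞) (by simp)).differentiableAt_of_isOpen hU hx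
  have hsym : IsSymmSndFDerivAt ℝ s x :=
    (hs.contDiffAt (hU.mem_nhds hx)).isSymmSndFDerivAt (by simpa using ENat.LEInfty.out)
  have key : ∀ v w : ℝ × ℝ, fderiv ℝ (fun z => fderiv ℝ s z v) x w =
      fderiv ℝ (fderiv ℝ s) x w v := by
    intro v w
    rw [fderiv_clm_apply hd (differentiableAt_const v)]
    simp
  change fderiv ℝ (fun z => fderiv ℝ s z (1, 0)) x (0, 1) =
    fderiv ℝ (fun z => fderiv ℝ s z (0, 1)) x (1, 0)
  rw [key, key, hsym]

theorem fderiv_mink {a b : ℝ × ℝ → R31} {x : ℝ × ℝ} (ha : DifferentiableAt ℝ a x)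
    (hb : DifferentiableAt ℝ b x) (w : ℝ × ℝ) :
    fderiv ℝ (fun z => mink (a z) (b z)) x w =
      mink (fderiv ℝ a x w) (b x) + mink (a x) (fderiv ℝ b x w) := by
  have ca := fun i => hasFDerivAt_pi'.1 ha.hasFDerivAt i
  have cb := fun i => hasFDerivAt_pi'.1 hb.hasFDerivAt i
  have := ((((ca 0).mul (cb 0)).neg.add ((ca 1).mul (cb 1))).add ((ca 2).mul (cb 2))).add
    ((ca 3).mul (cb 3))
  have h2 : HasFDerivAt (fun z => mink (a z) (b z)) _ x := this
  rw [h2.fderiv]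
  simp [mink]
  ring

theorem mink_fderiv_of_const {U : Set (ℝ × ℝ)} (hU : IsOpen U) {a b : ℝ × ℝ → R31}
    (ha : ContDiffOn ℝ ∞ a U) (hb : ContDiffOn ℝ ∞ b U) {c : ℝ}
    (h : ∀ x ∈ U, mink (a x) (b x) = c) {x : ℝ × ℝ} (hx : x ∈ U) (w : ℝ × ℝ) :
    mink (fderiv ℝ a x w) (b x) + mink (a x) (fderiv ℝ b x w) = 0 := by
  rw [← fderiv_mink (ha.differentiableAt_of_isOpen hU hx) (hb.differentiableAt_of_isOpen hU hx),
    fderiv_congr_of_isOpen hU h hx]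
  simp

theorem ContDiffOn.mink {U : Set (ℝ × ℝ)} {a b : ℝ × ℝ → R31}
    (ha : ContDiffOn ℝ ∞ a U) (hb : ContDiffOn ℝ ∞ b U) :
    ContDiffOn ℝ ∞ (fun z => mink (a z) (b z)) U := by
  have ca := fun i => contDiffOn_pi.1 ha i
  have cb := fun i => contDiffOn_pi.1 hb i
  exact ((((ca 0).mul (cb 0)).neg.add ((ca 1).mul (cb 1))).add ((ca 2).mul (cb 2))).add
    ((ca 3).mul (cb 3))

/-! ## Frames of pairs of hyperbolic Gauss maps -/

/-- `(e₁, e₂, g, h)` is a smooth adapted frame with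
`dg = ξ (α e₁ du + β e₂ dv)`, `dh = η (-α e₁ du + β e₂ dv)` and `θ = (de₁, e₂)`. -/
structure IsNullFrame (U : Set (ℝ × ℝ)) (e₁ e₂ g h : ℝ × ℝ → R31) (α β ξ η : ℝ × ℝ → ℝ)
    (θ : ℝ × ℝ → ℝ × ℝ → ℝ) : Prop where
  smooth_e₁ : ContDiffOn ℝ ∞ e₁ U
  smooth_e₂ : ContDiffOn ℝ ∞ e₂ U
  smooth_g : ContDiffOn ℝ ∞ g U
  smooth_h : ContDiffOn ℝ ∞ h U
  gram : ∀ x ∈ U, ∀ i j, mink (![e₁ x, e₂ x, g x, h x] i) (![e₁ x, e₂ x, g x, h x] j) =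
    frameGram ℝ i j
  fderiv_g : ∀ x ∈ U, ∀ w, fderiv ℝ g x w =
    (ξ x * α x * w.1) • e₁ x + (ξ x * β x * w.2) • e₂ x
  fderiv_h : ∀ x ∈ U, ∀ w, fderiv ℝ h x w =
    (-(η x * α x * w.1)) • e₁ x + (η x * β x * w.2) • e₂ x
  rotation : ∀ x ∈ U, ∀ w, mink (fderiv ℝ e₁ x w) (e₂ x) = θ x w
  α_ne : ∀ x ∈ U, α x ≠ 0
  β_ne : ∀ x ∈ U, β x ≠ 0
  ξ_ne : ∀ x ∈ U, ξ x ≠ 0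
  η_ne : ∀ x ∈ U, η x ≠ 0

/-- The connection matrix of a null frame. -/
noncomputable def nullFrameConnection (α β ξ η : ℝ × ℝ → ℝ) (θ : ℝ × ℝ → ℝ × ℝ → ℝ)
    (x w : ℝ × ℝ) : Matrix (Fin 4) (Fin 4) ℝ :=
  !![0, -θ x w, ξ x * α x * w.1, -(η x * α x * w.1);
     θ x w, 0, ξ x * β x * w.2, η x * β x * w.2;
     η x * α x * w.1 / 2, -(η x * β x * w.2 / 2), 0, 0;
     -(ξ x * α x * w.1 / 2), -(ξ x * β x * w.2 / 2), 0, 0]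

theorem kPart_nullFrameConnection (α β ξ η : ℝ × ℝ → ℝ) (θ : ℝ × ℝ → ℝ × ℝ → ℝ)
    (x w : ℝ × ℝ) : kPart (nullFrameConnection α β ξ η θ x w) =
      !![0, -θ x w, 0, 0; θ x w, 0, 0, 0; 0, 0, 0, 0; 0, 0, 0, 0] := by
  ext i j
  fin_cases i <;> fin_cases j <;> simp [kPart, nullFrameConnection]

theorem pPart_nullFrameConnection (α β ξ η : ℝ × ℝ → ℝ) (θ : ℝ × ℝ → ℝ × ℝ → ℝ)
    (x w : ℝ × ℝ) : pPart (nullFrameConnection α β ξ η θ x w) =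
      !![0, 0, ξ x * α x * w.1, -(η x * α x * w.1);
         0, 0, ξ x * β x * w.2, η x * β x * w.2;
         η x * α x * w.1 / 2, -(η x * β x * w.2 / 2), 0, 0;
         -(ξ x * α x * w.1 / 2), -(ξ x * β x * w.2 / 2), 0, 0] := by
  ext i j
  fin_cases i <;> fin_cases j <;> simp [pPart, nullFrameConnection]

namespace IsNullFrame

variable {U : Set (ℝ × ℝ)} {e₁ e₂ g h : ℝ × ℝ → R31} {α β ξ η : ℝ × ℝ → ℝ}
  {θ : ℝ × ℝ → ℝ × ℝ → ℝ}

theorem inner_e₁_e₁ (H : IsNullFrame U e₁ e₂ g h α β ξ η θ) {x : ℝ × ℝ} (hx : x ∈ U) :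
    mink (e₁ x) (e₁ x) = 1 := by simpa [frameGram] using H.gram x hx 0 0
theorem inner_e₂_e₂ (H : IsNullFrame U e₁ e₂ g h α β ξ η θ) {x : ℝ × ℝ} (hx : x ∈ U) :
    mink (e₂ x) (e₂ x) = 1 := by simpa [frameGram] using H.gram x hx 1 1
theorem inner_e₁_e₂ (H : IsNullFrame U e₁ e₂ g h α β ξ η θ) {x : ℝ × ℝ} (hx : x ∈ U) :
    mink (e₁ x) (e₂ x) = 0 := by simpa [frameGram] using H.gram x hx 0 1
theorem inner_e₁_g (H : IsNullFrame U e₁ e₂ g h α β ξ η θ) {x : ℝ × ℝ} (hx : x ∈ U) :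
    mink (e₁ x) (g x) = 0 := by simpa [frameGram] using H.gram x hx 0 2
theorem inner_e₁_h (H : IsNullFrame U e₁ e₂ g h α β ξ η θ) {x : ℝ × ℝ} (hx : x ∈ U) :
    mink (e₁ x) (h x) = 0 := by simpa [frameGram] using H.gram x hx 0 3
theorem inner_e₂_g (H : IsNullFrame U e₁ e₂ g h α β ξ η θ) {x : ℝ × ℝ} (hx : x ∈ U) :
    mink (e₂ x) (g x) = 0 := by simpa [frameGram] using H.gram x hx 1 2
theorem inner_e₂_h (H : IsNullFrame U e₁ e₂ g h α β ξ η θ) {x : ℝ × ℝ} (hx : x ∈ U) :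
    mink (e₂ x) (h x) = 0 := by simpa [frameGram] using H.gram x hx 1 3
theorem inner_g_g (H : IsNullFrame U e₁ e₂ g h α β ξ η θ) {x : ℝ × ℝ} (hx : x ∈ U) :
    mink (g x) (g x) = 0 := by simpa [frameGram] using H.gram x hx 2 2
theorem inner_g_h (H : IsNullFrame U e₁ e₂ g h α β ξ η θ) {x : ℝ × ℝ} (hx : x ∈ U) :
    mink (g x) (h x) = 2 := by simpa [frameGram] using H.gram x hx 2 3
theorem inner_h_h (H : IsNullFrame U e₁ e₂ g h α β ξ η θ) {x : ℝ × ℝ} (hx : x ∈ U) :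
    mink (h x) (h x) = 0 := by simpa [frameGram] using H.gram x hx 3 3

/-- Differentiating the Gram relations gives all pairings of `de₁` with the frame from `dg`, `dh`
and `θ`; `frame_expansion` turns them into coefficients. -/
theorem fderiv_e₁ (H : IsNullFrame U e₁ e₂ g h α β ξ η θ) (hU : IsOpen U) {x : ℝ × ℝ}
    (hx : x ∈ U) (w : ℝ × ℝ) : fderiv ℝ e₁ x w =
      θ x w • e₂ x + (η x * α x * w.1 / 2) • g x + (-(ξ x * α x * w.1 / 2)) • h x := by
  have h0 := mink_fderiv_of_const hU H.smooth_e₁ H.smooth_e₁ (fun x => H.inner_e₁_e₁) hx w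
  have h2 := mink_fderiv_of_const hU H.smooth_e₁ H.smooth_g (fun x => H.inner_e₁_g) hx w
  have h3 := mink_fderiv_of_const hU H.smooth_e₁ H.smooth_h (fun x => H.inner_e₁_h) hx w
  rw [mink_comm (e₁ x)] at h0
  simp only [H.fderiv_g x hx, H.fderiv_h x hx, mink_add_right, mink_smul_right,
    H.inner_e₁_e₁ hx, H.inner_e₁_e₂ hx] at h2 h3
  have h0' : mink (fderiv ℝ e₁ x w) (e₁ x) = 0 := by linarith
  have h2' : mink (fderiv ℝ e₁ x w) (g x) = -(ξ x * α x * w.1) := by linarith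
  have h3' : mink (fderiv ℝ e₁ x w) (h x) = η x * α x * w.1 := by linarith
  have key := frame_expansion (H.gram x hx) (fderiv ℝ e₁ x w)
  simp only [Matrix.cons_val, h0', h2', h3', H.rotation x hx w] at key
  rw [key]
  module

theorem fderiv_e₂ (H : IsNullFrame U e₁ e₂ g h α β ξ η θ) (hU : IsOpen U) {x : ℝ × ℝ}
    (hx : x ∈ U) (w : ℝ × ℝ) : fderiv ℝ e₂ x w =
      (-θ x w) • e₁ x + (-(η x * β x * w.2 / 2)) • g x + (-(ξ x * β x * w.2 / 2)) • h x := by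
  have h0 := mink_fderiv_of_const hU H.smooth_e₂ H.smooth_e₂ (fun x => H.inner_e₂_e₂) hx w
  have h1 := mink_fderiv_of_const hU H.smooth_e₁ H.smooth_e₂ (fun x => H.inner_e₁_e₂) hx w
  have h2 := mink_fderiv_of_const hU H.smooth_e₂ H.smooth_g (fun x => H.inner_e₂_g) hx w
  have h3 := mink_fderiv_of_const hU H.smooth_e₂ H.smooth_h (fun x => H.inner_e₂_h) hx w
  rw [mink_comm (e₂ x)] at h0
  rw [H.rotation x hx, mink_comm (e₁ x)] at h1
  have h12 : mink (e₂ x) (e₁ x) = 0 := by rw [mink_comm, H.inner_e₁_e₂ hx]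
  simp only [H.fderiv_g x hx, H.fderiv_h x hx, mink_add_right, mink_smul_right,
    H.inner_e₂_e₂ hx, h12] at h2 h3
  have h0' : mink (fderiv ℝ e₂ x w) (e₂ x) = 0 := by linarith
  have h1' : mink (fderiv ℝ e₂ x w) (e₁ x) = -θ x w := by linarith
  have h2' : mink (fderiv ℝ e₂ x w) (g x) = -(ξ x * β x * w.2) := by linarith
  have h3' : mink (fderiv ℝ e₂ x w) (h x) = -(η x * β x * w.2) := by linarith
  have key := frame_expansion (H.gram x hx) (fderiv ℝ e₂ x w)
  simp only [Matrix.cons_val, h0', h1', h2', h3'] at key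
  rw [key]
  module

theorem isAdaptedFrame (H : IsNullFrame U e₁ e₂ g h α β ξ η θ) :
    IsAdaptedFrame ℝ U (fun x => (Submodule.span ℝ {g x}, Submodule.span ℝ {h x}))
      (fun x => ![e₁ x, e₂ x, g x, h x]) where
  smooth := by
    refine contDiffOn_pi.2 fun i => ?_
    fin_cases i
    exacts [H.smooth_e₁, H.smooth_e₂, H.smooth_g, H.smooth_h]
  gram := H.gram
  plus x _ := ⟨g x, Submodule.mem_span_singleton_self _, 1, by simp⟩
  minus x _ := ⟨h x, Submodule.mem_span_singleton_self _, 1, by simp⟩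

theorem isConnectionForm (H : IsNullFrame U e₁ e₂ g h α β ξ η θ) (hU : IsOpen U) :
    IsConnectionForm U (fun x => ![e₁ x, e₂ x, g x, h x])
      (nullFrameConnection α β ξ η θ) := by
  intro x hx w j
  fin_cases j
  · change fderiv ℝ e₁ x w = _
    rw [H.fderiv_e₁ hU hx]
    simp [Fin.sum_univ_four, nullFrameConnection]
  · change fderiv ℝ e₂ x w = _
    rw [H.fderiv_e₂ hU hx]
    simp [Fin.sum_univ_four, nullFrameConnection]
  · change fderiv ℝ g x w = _
    rw [H.fderiv_g x hx]
    simp [Fin.sum_univ_four, nullFrameConnection]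
  · change fderiv ℝ h x w = _
    rw [H.fderiv_h x hx]
    simp [Fin.sum_univ_four, nullFrameConnection]

/-- The `du` part acts in the plane of `e₁` and `η g - ξ h`, the `dv` part in that of `e₂` and `η g
+ ξ h`. The opposite signs in `dg` and `dh` make these planes orthogonal, so the two parts commute.
Injectivity is read off from `dg`, whose coefficients do not vanish. -/
theorem isCurvedFlat (H : IsNullFrame U e₁ e₂ g h α β ξ η θ) (hU : IsOpen U) :
    IsCurvedFlat U (fun x => (Submodule.span ℝ {g x}, Submodule.span ℝ {h x})) := by
  refine ⟨_, _, H.isAdaptedFrame, H.isConnectionForm hU,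
    fun x hx => ⟨fun w w' => ?_, fun w hw => ?_⟩⟩
  · rw [Commute, SemiconjBy, pPart_nullFrameConnection, pPart_nullFrameConnection]
    ext i j
    fin_cases i <;> fin_cases j <;> simp [Matrix.mul_apply, Fin.sum_univ_four] <;> ring
  · rw [pPart_nullFrameConnection] at hw
    have h1 := congrFun (congrFun hw 0) 2
    have h2 := congrFun (congrFun hw 1) 2
    simp [H.ξ_ne x hx, H.α_ne x hx, H.β_ne x hx] at h1 h2
    exact Prod.ext h1 h2

/-- Used when `(g - h) / 2` lies on the lower sheet of the hyperboloid. -/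
theorem neg (H : IsNullFrame U e₁ e₂ g h α β ξ η θ) :
    IsNullFrame U e₁ e₂ (-g) (-h) α β (-ξ) (-η) θ where
  smooth_e₁ := H.smooth_e₁
  smooth_e₂ := H.smooth_e₂
  smooth_g := H.smooth_g.neg
  smooth_h := H.smooth_h.neg
  gram x hx i j := by
    have := H.gram x hx i j
    fin_cases i <;> fin_cases j <;>
      simpa [frameGram, mink_neg_left, mink_neg_right] using this
  fderiv_g x hx w := by
    rw [fderiv_neg, neg_apply, H.fderiv_g x hx]
    simp only [Pi.neg_apply]
    module
  fderiv_h x hx w := by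
    rw [fderiv_neg, neg_apply, H.fderiv_h x hx]
    simp only [Pi.neg_apply]
    module
  rotation := H.rotation
  α_ne := H.α_ne
  β_ne := H.β_ne
  ξ_ne x hx := neg_ne_zero.2 (H.ξ_ne x hx)
  η_ne x hx := neg_ne_zero.2 (H.η_ne x hx)

theorem fderiv_half_sub (H : IsNullFrame U e₁ e₂ g h α β ξ η θ) (hU : IsOpen U) {x : ℝ × ℝ}
    (hx : x ∈ U) (w : ℝ × ℝ) : fderiv ℝ ((1 / 2 : ℝ) • (g - h)) x w =
      ((ξ x + η x) / 2 * α x * w.1) • e₁ x + ((ξ x - η x) / 2 * β x * w.2) • e₂ x := by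
  have hg := H.smooth_g.differentiableAt_of_isOpen hU hx
  have hh := H.smooth_h.differentiableAt_of_isOpen hU hx
  rw [fderiv_const_smul (hg.sub hh), fderiv_sub hg hh, smul_apply,
    sub_apply, H.fderiv_g x hx, H.fderiv_h x hx]
  module

theorem fderiv_half_add (H : IsNullFrame U e₁ e₂ g h α β ξ η θ) (hU : IsOpen U) {x : ℝ × ℝ}
    (hx : x ∈ U) (w : ℝ × ℝ) : fderiv ℝ ((1 / 2 : ℝ) • (g + h)) x w =
      ((ξ x - η x) / 2 * α x * w.1) • e₁ x + ((ξ x + η x) / 2 * β x * w.2) • e₂ x := by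
  have hg := H.smooth_g.differentiableAt_of_isOpen hU hx
  have hh := H.smooth_h.differentiableAt_of_isOpen hU hx
  rw [fderiv_const_smul (hg.add hh), fderiv_add hg hh, smul_apply,
    add_apply, H.fderiv_g x hx, H.fderiv_h x hx]
  module

theorem norm_half_sub (H : IsNullFrame U e₁ e₂ g h α β ξ η θ) {x : ℝ × ℝ} (hx : x ∈ U) :
    mink (((1 / 2 : ℝ) • (g - h)) x) (((1 / 2 : ℝ) • (g - h)) x) = -1 := by
  simp only [Pi.smul_apply, Pi.sub_apply, mink_smul_left, mink_smul_right, mink_sub_left,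
    mink_sub_right, H.inner_g_g hx, H.inner_h_h hx, mink_comm (h x) (g x), H.inner_g_h hx]
  norm_num

/-- A null frame with `(g - h) / 2` on the upper sheet of the hyperboloid is the frame of a flat
front. -/
theorem isFlatFront (H : IsNullFrame U e₁ e₂ g h α β ξ η θ) (hU : IsOpen U)
    (hpos : ∀ x ∈ U, 0 < ((1 / 2 : ℝ) • (g - h)) x 0) :
    IsFlatFront U ((1 / 2 : ℝ) • (g - h)) ((1 / 2 : ℝ) • (g + h)) where
  smooth_f := contDiffOn_const.smul (H.smooth_g.sub H.smooth_h)
  smooth_t := contDiffOn_const.smul (H.smooth_g.add H.smooth_h)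
  norm_f x hx := H.norm_half_sub hx
  pos_f := hpos
  norm_t x hx := by
    simp only [Pi.smul_apply, Pi.add_apply, mink_smul_left, mink_smul_right, mink_add_left,
      mink_add_right, H.inner_g_g hx, H.inner_h_h hx, mink_comm (h x) (g x), H.inner_g_h hx]
    norm_num
  orth x hx := by
    simp only [Pi.smul_apply, Pi.add_apply, Pi.sub_apply, mink_smul_left, mink_smul_right,
      mink_sub_left, mink_add_right, H.inner_g_g hx, H.inner_h_h hx, mink_comm (h x) (g x),
      H.inner_g_h hx]
    norm_num
  normal x hx w := by
    rw [H.fderiv_half_sub hU hx]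
    simp only [Pi.smul_apply, Pi.add_apply, mink_smul_left, mink_smul_right, mink_add_left,
      mink_add_right, H.inner_e₁_g hx, H.inner_e₁_h hx, H.inner_e₂_g hx, H.inner_e₂_h hx]
    ring
  immersed x hx w h1 h2 := by
    rw [H.fderiv_half_sub hU hx] at h1
    rw [H.fderiv_half_add hU hx] at h2
    have a1 := congrArg (mink (e₁ x)) h1
    have a2 := congrArg (mink (e₁ x)) h2
    have b1 := congrArg (mink (e₂ x)) h1
    have b2 := congrArg (mink (e₂ x)) h2
    have hz : ∀ y : R31, mink y 0 = 0 := fun y => by simp [mink]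
    simp only [mink_add_right, mink_smul_right, H.inner_e₁_e₁ hx, H.inner_e₂_e₂ hx,
      H.inner_e₁_e₂ hx, mink_comm (e₂ x) (e₁ x), hz] at a1 a2 b1 b2
    have c1 : ξ x * α x * w.1 = 0 := by linarith
    have c2 : ξ x * β x * w.2 = 0 := by linarith
    simp only [mul_eq_zero, H.ξ_ne x hx, H.α_ne x hx, H.β_ne x hx, false_or] at c1 c2
    exact Prod.ext c1 c2
  -- Passing from `(g - h) / 2` to `(g + h) / 2` exchanges the factors `(ξ + η) / 2` and `(ξ - η) /
  -- 2` of the two principal derivatives, so the area factor `(ξ² - η²) α β / 4` is the same for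
  -- both.
  flat x hx := by
    rw [dU, dV, dU, dV, H.fderiv_half_sub hU hx, H.fderiv_half_sub hU hx,
      H.fderiv_half_add hU hx, H.fderiv_half_add hU hx]
    simp [Matrix.det_succ_row_zero, Fin.sum_univ_succ, Fin.succAbove]
    ring

/-- Frames with the same rotation form whose null directions are scaled by constants belong to
one curved flat associated family. -/
theorem isAssociatedCurvedFlat {𝕜 : Type*} [RCLike 𝕜] {e₁' e₂' g' h' : ℝ × ℝ → R31}
    {ξ' η' : ℝ × ℝ → ℝ} {c d : ℝ}
    (H : IsNullFrame U e₁ e₂ g h α β ξ η θ) (H' : IsNullFrame U e₁' e₂' g' h' α β ξ' η' θ)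
    (hU : IsOpen U) (hξ : ∀ x ∈ U, ξ' x = c * ξ x) (hη : ∀ x ∈ U, η' x = d * η x)
    (hcd : c * d ≠ 0) {μ : 𝕜} (hμ : μ ^ 2 = algebraMap ℝ 𝕜 (c * d)) :
    IsAssociatedCurvedFlat 𝕜 U μ (fun x => (Submodule.span ℝ {g x}, Submodule.span ℝ {h x}))
      (fun x => (Submodule.span ℝ {g' x}, Submodule.span ℝ {h' x})) := by
  have hc : algebraMap ℝ 𝕜 c ≠ 0 := by simpa using left_ne_zero_of_mul hcd
  have hd : algebraMap ℝ 𝕜 d ≠ 0 := by simpa using right_ne_zero_of_mul hcd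
  rw [map_mul] at hμ
  -- `L` is the coordinatewise extension of scalars, through which real frames are differentiated as
  -- `𝕜`-valued ones.
  let L : R31 →L[ℝ] (Fin 4 → 𝕜) := ContinuousLinearMap.pi fun k =>
    (Algebra.linearMap ℝ 𝕜).toContinuousLinearMap.comp (ContinuousLinearMap.proj k)
  have hLm : ∀ y z, mink (L y) (L z) = algebraMap ℝ 𝕜 (mink y z) := mink_algebraMap
  have hLs : ∀ (r : ℝ) (y : R31), L (r • y) = algebraMap ℝ 𝕜 r • L y := by
    intro r y; rw [map_smul]; ext k; simp [RCLike.real_smul_eq_coe_mul]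
  have hsm : ∀ {s : ℝ × ℝ → R31}, ContDiffOn ℝ ∞ s U → ∀ r : 𝕜,
      ContDiffOn ℝ ∞ (fun x => r • L (s x)) U := fun hs r =>
    (L.contDiff.comp_contDiffOn hs).const_smul r
  have hfd : ∀ {s : ℝ × ℝ → R31}, ContDiffOn ℝ ∞ s U → ∀ (r : 𝕜) {x}, x ∈ U → ∀ w,
      fderiv ℝ (fun x => r • L (s x)) x w = r • L (fderiv ℝ s x w) := by
    intro s hs r x hx w
    have h1 := (L.hasFDerivAt.comp x (hs.differentiableAt_of_isOpen hU hx).hasFDerivAt).const_smul r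
    have h2 : HasFDerivAt (fun x => r • L (s x)) _ x := h1
    rw [h2.fderiv]
    rfl
  -- Since `μ² = c d`, the factors `μ / c` and `μ / d` have product `1` and preserve the Gram
  -- matrix; they turn the scalings `c ξ`, `d η` into `μ ξ`, `μ η`. The factors `1` only give all
  -- four columns a common shape.
  refine ⟨_, _, fun x => ![(1 : 𝕜) • L (e₁' x), (1 : 𝕜) • L (e₂' x),
    (μ / algebraMap ℝ 𝕜 c) • L (g' x), (μ / algebraMap ℝ 𝕜 d) • L (h' x)],
    H.isAdaptedFrame, H.isConnectionForm hU, ⟨?_, ?_, ?_, ?_⟩, ?_⟩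
  · refine contDiffOn_pi.2 fun i => ?_
    fin_cases i
    exacts [hsm H'.smooth_e₁ _, hsm H'.smooth_e₂ _, hsm H'.smooth_g _, hsm H'.smooth_h _]
  · intro x hx i j
    have key := congrArg (algebraMap ℝ 𝕜) (H'.gram x hx i j)
    have h2 : μ / algebraMap ℝ 𝕜 c * (μ / algebraMap ℝ 𝕜 d) = 1 := by
      field_simp; exact hμ
    have h3 : μ / algebraMap ℝ 𝕜 d * (μ / algebraMap ℝ 𝕜 c) = 1 := by
      rw [mul_comm, h2]
    rw [← hLm] at key
    fin_cases i <;> fin_cases j <;>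
      simp only [Fin.zero_eta, Fin.mk_one, Fin.reduceFinMk, Matrix.cons_val, mink_smul_left,
        mink_smul_right, frameGram, Matrix.of_apply, map_zero, map_one] at key ⊢ <;>
      rw [key] <;> simp [← mul_assoc, h2, h3, map_ofNat]
  · exact fun x _ => ⟨g' x, Submodule.mem_span_singleton_self _, _, rfl⟩
  · exact fun x _ => ⟨h' x, Submodule.mem_span_singleton_self _, _, rfl⟩
  · intro x hx w j
    dsimp only
    rw [kPart_nullFrameConnection, pPart_nullFrameConnection]
    fin_cases j
    · change fderiv ℝ (fun x => (1 : 𝕜) • L (e₁' x)) x w = _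
      rw [hfd H'.smooth_e₁ _ hx, H'.fderiv_e₁ hU hx, hξ x hx, hη x hx]
      simp [Fin.sum_univ_four, hLs, -map_smul, -algebraMap_smul, map_ofNat]
      match_scalars <;> field_simp <;> try rw [hμ]; ring
    · change fderiv ℝ (fun x => (1 : 𝕜) • L (e₂' x)) x w = _
      rw [hfd H'.smooth_e₂ _ hx, H'.fderiv_e₂ hU hx, hξ x hx, hη x hx]
      simp [Fin.sum_univ_four, hLs, -map_smul, -algebraMap_smul, map_ofNat]
      match_scalars <;> field_simp <;> try rw [hμ]; ring
    · change fderiv ℝ (fun x => (μ / algebraMap ℝ 𝕜 c) • L (g' x)) x w = _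
      rw [hfd H'.smooth_g _ hx, H'.fderiv_g x hx, hξ x hx]
      simp [Fin.sum_univ_four, hLs, -map_smul, -algebraMap_smul]
      match_scalars <;> field_simp
    · change fderiv ℝ (fun x => (μ / algebraMap ℝ 𝕜 d) • L (h' x)) x w = _
      rw [hfd H'.smooth_h _ hx, H'.fderiv_h x hx, hη x hx]
      simp [Fin.sum_univ_four, hLs, -map_smul, -algebraMap_smul]
      match_scalars <;> field_simp

end IsNullFrame

/-! ## Flat fronts in curvature line coordinates -/

theorem span_pair_eq_of_det_ne_zero {V : Type*} [AddCommGroup V] [Module ℝ V] {a b c d : V}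
    {x y z w : ℝ} (hc : c = x • a + y • b) (hd : d = z • a + w • b) (hdet : x * w - y * z ≠ 0) :
    Submodule.span ℝ {c, d} = Submodule.span ℝ {a, b} := by
  obtain ⟨D, hD⟩ : ∃ D, D = x * w - y * z := ⟨_, rfl⟩
  rw [← hD] at hdet
  apply le_antisymm
  · rw [Submodule.span_le, Set.pair_subset_iff]
    exact ⟨Submodule.mem_span_pair.2 ⟨x, y, hc.symm⟩, Submodule.mem_span_pair.2 ⟨z, w, hd.symm⟩⟩
  · rw [Submodule.span_le, Set.pair_subset_iff]
    refine ⟨Submodule.mem_span_pair.2 ⟨w / D, -y / D, ?_⟩,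
      Submodule.mem_span_pair.2 ⟨-z / D, x / D, ?_⟩⟩ <;>
    · rw [hc, hd]
      match_scalars <;> field_simp <;> linarith

/-- The frame of the pair of hyperbolic Gauss maps of a flat front in curvature line
coordinates. -/
theorem IsFlatFront.exists_isNullFrame {U : Set (ℝ × ℝ)} (hU : IsOpen U)
    {f t : ℝ × ℝ → R31} {φ : ℝ × ℝ → ℝ} (hf : IsFlatFront U f t)
    (hφ : IsCurvatureLineParam U f t φ) :
    ∃ (e₁ e₂ : ℝ × ℝ → R31) (α β : ℝ × ℝ → ℝ) (θ : ℝ × ℝ → ℝ × ℝ → ℝ),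
      IsNullFrame U e₁ e₂ (t + f) (t - f) α β (fun x => Real.exp (-φ x))
        (fun x => Real.exp (φ x)) θ := by
  -- `a` and `b` are the principal directions that survive at singularities: `f_u`, `t_u` are
  -- multiples of `a` and `f_v`, `t_v` multiples of `b`, with hyperbolic functions of `φ` as
  -- coefficients.
  obtain ⟨a, ha⟩ : ∃ a : ℝ × ℝ → R31,
    a = fun x => Real.cosh (φ x) • dU f x + Real.sinh (φ x) • dU t x := ⟨_, rfl⟩
  obtain ⟨b, hb⟩ : ∃ b : ℝ × ℝ → R31,
    b = fun x => Real.sinh (φ x) • dV f x + Real.cosh (φ x) • dV t x := ⟨_, rfl⟩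
  have ftu : ∀ x ∈ U, dU f x = Real.cosh (φ x) • a x ∧ dU t x = -Real.sinh (φ x) • a x := by
    intro x hx
    have h := hφ.eq_u x hx
    have h2 := Real.cosh_sq' (φ x)
    subst ha
    constructor
    -- `f_u - cosh φ a` is `-sinh φ` times the left side of the curvature line equation; the other
    -- three identities arise in the same way.
    · refine sub_eq_zero.1 (Eq.trans ?_
        ((congrArg (fun y => (-Real.sinh (φ x)) • y) h).trans (smul_zero _)))
      match_scalars <;> linarith
    · refine sub_eq_zero.1 (Eq.trans ?_
        ((congrArg (fun y => (Real.cosh (φ x)) • y) h).trans (smul_zero _)))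
      match_scalars <;> linarith
  have ftv : ∀ x ∈ U, dV f x = -Real.sinh (φ x) • b x ∧ dV t x = Real.cosh (φ x) • b x := by
    intro x hx
    have h := hφ.eq_v x hx
    have h2 := Real.cosh_sq' (φ x)
    subst hb
    constructor
    · refine sub_eq_zero.1 (Eq.trans ?_
        ((congrArg (fun y => (Real.cosh (φ x)) • y) h).trans (smul_zero _)))
      match_scalars <;> linarith
    · refine sub_eq_zero.1 (Eq.trans ?_
        ((congrArg (fun y => (-Real.sinh (φ x)) • y) h).trans (smul_zero _)))
      match_scalars <;> linarith
  have sa : ContDiffOn ℝ ∞ a U := by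
    rw [ha]
    exact ((Real.contDiff_cosh.comp_contDiffOn hφ.smooth).smul
      (hf.smooth_f.fderiv_apply_of_isOpen hU _)).add
      ((Real.contDiff_sinh.comp_contDiffOn hφ.smooth).smul
      (hf.smooth_t.fderiv_apply_of_isOpen hU _))
  have sb : ContDiffOn ℝ ∞ b U := by
    rw [hb]
    exact ((Real.contDiff_sinh.comp_contDiffOn hφ.smooth).smul
      (hf.smooth_f.fderiv_apply_of_isOpen hU _)).add
      ((Real.contDiff_cosh.comp_contDiffOn hφ.smooth).smul
      (hf.smooth_t.fderiv_apply_of_isOpen hU _))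
  have hff : ∀ x ∈ U, ∀ w, mink (fderiv ℝ f x w) (f x) = 0 := by
    intro x hx w
    have h := mink_fderiv_of_const hU hf.smooth_f hf.smooth_f hf.norm_f hx w
    rw [mink_comm (f x)] at h
    linarith
  have htt : ∀ x ∈ U, ∀ w, mink (fderiv ℝ t x w) (t x) = 0 := by
    intro x hx w
    have h := mink_fderiv_of_const hU hf.smooth_t hf.smooth_t hf.norm_t hx w
    rw [mink_comm (t x)] at h
    linarith
  have hft : ∀ x ∈ U, ∀ w, mink (fderiv ℝ t x w) (f x) = 0 := by
    intro x hx w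
    have h := mink_fderiv_of_const hU hf.smooth_f hf.smooth_t hf.orth hx w
    rw [hf.normal x hx, mink_comm] at h
    linarith
  have af : ∀ x ∈ U, mink (a x) (f x) = 0 := by
    intro x hx
    simp [ha, mink_add_left, mink_smul_left, dU, hff x hx, hft x hx]
  have hat : ∀ x ∈ U, mink (a x) (t x) = 0 := by
    intro x hx
    simp [ha, mink_add_left, mink_smul_left, dU, hf.normal x hx, htt x hx]
  have bf : ∀ x ∈ U, mink (b x) (f x) = 0 := by
    intro x hx
    simp [hb, mink_add_left, mink_smul_left, dV, hff x hx, hft x hx]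
  have bt : ∀ x ∈ U, mink (b x) (t x) = 0 := by
    intro x hx
    simp [hb, mink_add_left, mink_smul_left, dV, hf.normal x hx, htt x hx]
  have ab : ∀ x ∈ U, mink (a x) (b x) = 0 := by
    intro x hx
    -- Differentiating `(f_u, t) = 0 = (f_v, t)` and using `f_uv = f_vu` gives `(f_u, t_v) = (f_v,
    -- t_u)`, that is `cosh² φ (a, b) = sinh² φ (a, b)`.
    have h1 := mink_fderiv_of_const hU (hf.smooth_f.fderiv_apply_of_isOpen hU (1, 0))
      hf.smooth_t (fun x hx => hf.normal x hx (1, 0)) hx (0, 1)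
    have h2 := mink_fderiv_of_const hU (hf.smooth_f.fderiv_apply_of_isOpen hU (0, 1))
      hf.smooth_t (fun x hx => hf.normal x hx (0, 1)) hx (1, 0)
    change mink (dV (dU f) x) (t x) + mink (dU f x) (dV t x) = 0 at h1
    change mink (dU (dV f) x) (t x) + mink (dV f x) (dU t x) = 0 at h2
    rw [dV_dU_comm hU hf.smooth_f hx] at h1
    simp only [ftu x hx, ftv x hx, mink_smul_left, mink_smul_right, mink_comm (b x) (a x)]
      at h1 h2
    linear_combination h1 - h2 - mink (a x) (b x) * Real.cosh_sq' (φ x)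
  have a0 : ∀ x ∈ U, 0 < mink (a x) (a x) := by
    intro x hx
    -- If `a` vanished, then `f_u` and `t_u` would both vanish, contradicting that `(f, t)` is an
    -- immersion.
    refine mink_self_pos_of_orthogonal (hf.norm_f x hx) (by rw [mink_comm, af x hx]) fun h => ?_
    have := hf.immersed x hx (1, 0) (by change dU f x = 0; simp [ftu x hx, h])
      (by change dU t x = 0; simp [ftu x hx, h])
    simp at this
  have b0 : ∀ x ∈ U, 0 < mink (b x) (b x) := by
    intro x hx
    refine mink_self_pos_of_orthogonal (hf.norm_f x hx) (by rw [mink_comm, bf x hx]) fun h => ?_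
    have := hf.immersed x hx (0, 1) (by change dV f x = 0; simp [ftv x hx, h])
      (by change dV t x = 0; simp [ftv x hx, h])
    simp at this
  have hα : ∀ x ∈ U, √(mink (a x) (a x)) ≠ 0 := fun x hx => (Real.sqrt_pos.2 (a0 x hx)).ne'
  have hβ : ∀ x ∈ U, √(mink (b x) (b x)) ≠ 0 := fun x hx => (Real.sqrt_pos.2 (b0 x hx)).ne'
  have sqα : ∀ x ∈ U, √(mink (a x) (a x)) ^ 2 = mink (a x) (a x) := fun x hx =>
    Real.sq_sqrt (a0 x hx).le
  have sqβ : ∀ x ∈ U, √(mink (b x) (b x)) ^ 2 = mink (b x) (b x) := fun x hx =>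
    Real.sq_sqrt (b0 x hx).le
  have unit : ∀ r m : ℝ, r ≠ 0 → r ^ 2 = m → r⁻¹ * (r⁻¹ * m) = 1 := by
    intro r m hr h
    rw [← h]
    field_simp
  have expm : ∀ y : ℝ, Real.exp (-y) = Real.cosh y - Real.sinh y := fun y =>
    (Real.cosh_sub_sinh y).symm
  have expp : ∀ y : ℝ, Real.exp y = Real.cosh y + Real.sinh y := fun y =>
    (Real.cosh_add_sinh y).symm
  refine ⟨fun x => (√(mink (a x) (a x)))⁻¹ • a x, fun x => (√(mink (b x) (b x)))⁻¹ • b x,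
    fun x => √(mink (a x) (a x)), fun x => √(mink (b x) (b x)), _,
    ⟨?_, ?_, hf.smooth_t.add hf.smooth_f, hf.smooth_t.sub hf.smooth_f, ?_, ?_, ?_,
    fun _ _ _ => rfl, hα, hβ, fun x _ => (Real.exp_pos _).ne', fun x _ => (Real.exp_pos _).ne'⟩⟩
  · exact (((sa.mink sa).sqrt fun x hx => (a0 x hx).ne').inv hα).smul sa
  · exact (((sb.mink sb).sqrt fun x hx => (b0 x hx).ne').inv hβ).smul sb
  · intro x hx i j
    fin_cases i <;> fin_cases j <;>
      simp [mink_smul_left, mink_smul_right, mink_add_left, mink_add_right, mink_sub_left,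
        mink_sub_right, frameGram, unit _ _ (hα x hx) (sqα x hx), unit _ _ (hβ x hx) (sqβ x hx),
        ab x hx, mink_comm (b x) (a x), af x hx, hat x hx, bf x hx, bt x hx,
        mink_comm (f x) (a x), mink_comm (f x) (b x), mink_comm (t x) (a x),
        mink_comm (t x) (b x), hf.norm_f x hx, hf.norm_t x hx, hf.orth x hx,
        mink_comm (t x) (f x)] <;> norm_num
  · intro x hx w
    have d1 := hf.smooth_f.differentiableAt_of_isOpen hU hx
    have d2 := hf.smooth_t.differentiableAt_of_isOpen hU hx
    rw [fderiv_add d2 d1, add_apply, fderiv_eq_dU_dV f, fderiv_eq_dU_dV t, (ftu x hx).1,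
      (ftu x hx).2, (ftv x hx).1, (ftv x hx).2]
    have h1 := hα x hx
    have h2 := hβ x hx
    rw [expm]
    match_scalars <;> field_simp <;> ring
  · intro x hx w
    have d1 := hf.smooth_f.differentiableAt_of_isOpen hU hx
    have d2 := hf.smooth_t.differentiableAt_of_isOpen hU hx
    rw [fderiv_sub d2 d1, sub_apply, fderiv_eq_dU_dV f, fderiv_eq_dU_dV t, (ftu x hx).1,
      (ftu x hx).2, (ftv x hx).1, (ftv x hx).2]
    have h1 := hα x hx
    have h2 := hβ x hx
    rw [expp]
    match_scalars <;> field_simp <;> ring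

/-! ## The Moutard lifts -/

/-- The lift `q⁺ + g` of a null direction. -/
noncomputable def liftPlus (g : ℝ × ℝ → R31) (x : ℝ × ℝ) : R42 := qPlus + incl (g x)

/-- The lift `q⁻ + h` of a null direction. -/
noncomputable def liftMinus (h : ℝ × ℝ → R31) (x : ℝ × ℝ) : R42 := qMinus + incl (h x)

/-- The isothermic sphere congruences of the front are thus its hyperbolic Gauss maps, lifted to
`ℝ^{4,2}`; the scaling by `e^{±φ}` makes the lifts Moutard. -/
theorem curvSphere_add (f t : ℝ × ℝ → R31) (φ : ℝ × ℝ → ℝ) (x : ℝ × ℝ) :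
    curvSphere₁ f t φ x + curvSphere₂ f t φ x = Real.exp (φ x) • liftPlus (t + f) x := by
  simp only [curvSphere₁, curvSphere₂, liftPlus, qPlus, Pi.add_apply, ← inclL_apply, map_add,
    ← Real.cosh_add_sinh]
  module

theorem curvSphere_sub (f t : ℝ × ℝ → R31) (φ : ℝ × ℝ → ℝ) (x : ℝ × ℝ) :
    curvSphere₁ f t φ x - curvSphere₂ f t φ x = Real.exp (-φ x) • liftMinus (t - f) x := by
  simp only [curvSphere₁, curvSphere₂, liftMinus, qMinus, Pi.sub_apply, ← inclL_apply, map_sub,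
    ← Real.cosh_sub_sinh]
  module

theorem ContDiffOn.liftPlus {U : Set (ℝ × ℝ)} {g : ℝ × ℝ → R31} (hg : ContDiffOn ℝ ∞ g U) :
    ContDiffOn ℝ ∞ (liftPlus g) U :=
  contDiffOn_const.add (inclL.contDiff.comp_contDiffOn hg)

theorem ContDiffOn.liftMinus {U : Set (ℝ × ℝ)} {g : ℝ × ℝ → R31} (hg : ContDiffOn ℝ ∞ g U) :
    ContDiffOn ℝ ∞ (liftMinus g) U :=
  contDiffOn_const.add (inclL.contDiff.comp_contDiffOn hg)

theorem hasFDerivAt_liftPlus {g : ℝ × ℝ → R31} {x : ℝ × ℝ} (hg : DifferentiableAt ℝ g x) :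
    HasFDerivAt (liftPlus g) (inclL.comp (fderiv ℝ g x)) x :=
  (inclL.hasFDerivAt.comp x hg.hasFDerivAt).const_add qPlus

theorem hasFDerivAt_liftMinus {g : ℝ × ℝ → R31} {x : ℝ × ℝ} (hg : DifferentiableAt ℝ g x) :
    HasFDerivAt (liftMinus g) (inclL.comp (fderiv ℝ g x)) x :=
  (inclL.hasFDerivAt.comp x hg.hasFDerivAt).const_add qMinus

section Moutard
variable {U : Set (ℝ × ℝ)} {f t e₁ e₂ : ℝ × ℝ → R31} {φ α β : ℝ × ℝ → ℝ}
  {θ : ℝ × ℝ → ℝ × ℝ → ℝ}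

theorem contDiffOn_curvSphere_add (hf : ContDiffOn ℝ ∞ f U) (ht : ContDiffOn ℝ ∞ t U)
    (hφ : ContDiffOn ℝ ∞ φ U) :
    ContDiffOn ℝ ∞ (curvSphere₁ f t φ + curvSphere₂ f t φ) U :=
  (hφ.exp.smul (ht.add hf).liftPlus).congr fun x _ => curvSphere_add f t φ x

theorem contDiffOn_curvSphere_sub (hf : ContDiffOn ℝ ∞ f U) (ht : ContDiffOn ℝ ∞ t U)
    (hφ : ContDiffOn ℝ ∞ φ U) :
    ContDiffOn ℝ ∞ (curvSphere₁ f t φ - curvSphere₂ f t φ) U :=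
  (hφ.neg.exp.smul (ht.sub hf).liftMinus).congr fun x _ => curvSphere_sub f t φ x

/-- The factor `e^{φ}` of the lift cancels the `e^{-φ}` in `dg`, so `φ` enters only through a
multiple of `s⁺`. -/
theorem fderiv_curvSphere_add (hU : IsOpen U) (hφ : ContDiffOn ℝ ∞ φ U)
    (H : IsNullFrame U e₁ e₂ (t + f) (t - f) α β (fun x => Real.exp (-φ x))
      (fun x => Real.exp (φ x)) θ) {x : ℝ × ℝ} (hx : x ∈ U) (w : ℝ × ℝ) :
    fderiv ℝ (curvSphere₁ f t φ + curvSphere₂ f t φ) x w =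
      fderiv ℝ φ x w • (curvSphere₁ f t φ x + curvSphere₂ f t φ x) +
        (α x * w.1) • incl (e₁ x) + (β x * w.2) • incl (e₂ x) := by
  have h1 := (hφ.differentiableAt_of_isOpen hU hx).hasFDerivAt.exp.smul
    (hasFDerivAt_liftPlus (H.smooth_g.differentiableAt_of_isOpen hU hx))
  have h2 : curvSphere₁ f t φ + curvSphere₂ f t φ = fun x => Real.exp (φ x) • liftPlus (t + f) x :=
    funext fun x => curvSphere_add f t φ x
  rw [h2, curvSphere_add]
  refine (congrArg (fun L => L w) (HasFDerivAt.fderiv h1)).trans ?_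
  simp only [add_apply, smul_apply, ContinuousLinearMap.smulRight_apply,
    ContinuousLinearMap.comp_apply, smul_eq_mul, H.fderiv_g x hx, map_add, map_smul, inclL_apply]
  rw [Real.exp_neg]
  have := (Real.exp_pos (φ x)).ne'
  match_scalars <;> field_simp

theorem fderiv_curvSphere_sub (hU : IsOpen U) (hφ : ContDiffOn ℝ ∞ φ U)
    (H : IsNullFrame U e₁ e₂ (t + f) (t - f) α β (fun x => Real.exp (-φ x))
      (fun x => Real.exp (φ x)) θ) {x : ℝ × ℝ} (hx : x ∈ U) (w : ℝ × ℝ) :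
    fderiv ℝ (curvSphere₁ f t φ - curvSphere₂ f t φ) x w =
      -fderiv ℝ φ x w • (curvSphere₁ f t φ x - curvSphere₂ f t φ x) -
        (α x * w.1) • incl (e₁ x) + (β x * w.2) • incl (e₂ x) := by
  have h1 := (hφ.differentiableAt_of_isOpen hU hx).hasFDerivAt.neg.exp.smul
    (hasFDerivAt_liftMinus (H.smooth_h.differentiableAt_of_isOpen hU hx))
  have h2 : curvSphere₁ f t φ - curvSphere₂ f t φ =
      fun x => Real.exp (-φ x) • liftMinus (t - f) x :=
    funext fun x => curvSphere_sub f t φ x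
  rw [h2, curvSphere_sub]
  refine (congrArg (fun L => L w) (HasFDerivAt.fderiv h1)).trans ?_
  simp only [add_apply, smul_apply, neg_apply, ContinuousLinearMap.smulRight_apply,
    ContinuousLinearMap.comp_apply, smul_eq_mul, H.fderiv_h x hx, map_add, map_smul, inclL_apply,
    Pi.neg_apply]
  rw [Real.exp_neg]
  have := (Real.exp_pos (φ x)).ne'
  match_scalars <;> field_simp

/-- In the `u` direction the `e₁` terms of `ds⁺` and `ds⁻` are opposite and cancel in the half sum
`s₁`. -/
theorem dU_curvSphere₁ (hU : IsOpen U) (hf : ContDiffOn ℝ ∞ f U) (ht : ContDiffOn ℝ ∞ t U)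
    (hφ : ContDiffOn ℝ ∞ φ U)
    (H : IsNullFrame U e₁ e₂ (t + f) (t - f) α β (fun x => Real.exp (-φ x))
      (fun x => Real.exp (φ x)) θ) {x : ℝ × ℝ} (hx : x ∈ U) :
    dU (curvSphere₁ f t φ) x = dU φ x • curvSphere₂ f t φ x := by
  have h1 : curvSphere₁ f t φ = (1 / 2 : ℝ) • ((curvSphere₁ f t φ + curvSphere₂ f t φ) +
      (curvSphere₁ f t φ - curvSphere₂ f t φ)) := by module
  have d1 := (contDiffOn_curvSphere_add hf ht hφ).differentiableAt_of_isOpen hU hx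
  have d2 := (contDiffOn_curvSphere_sub hf ht hφ).differentiableAt_of_isOpen hU hx
  rw [dU, h1, fderiv_const_smul (d1.add d2), fderiv_add d1 d2, smul_apply, add_apply,
    fderiv_curvSphere_add hU hφ H hx, fderiv_curvSphere_sub hU hφ H hx, dU]
  module

theorem dV_curvSphere₂ (hU : IsOpen U) (hf : ContDiffOn ℝ ∞ f U) (ht : ContDiffOn ℝ ∞ t U)
    (hφ : ContDiffOn ℝ ∞ φ U)
    (H : IsNullFrame U e₁ e₂ (t + f) (t - f) α β (fun x => Real.exp (-φ x))
      (fun x => Real.exp (φ x)) θ) {x : ℝ × ℝ} (hx : x ∈ U) :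
    dV (curvSphere₂ f t φ) x = dV φ x • curvSphere₁ f t φ x := by
  have h1 : curvSphere₂ f t φ = (1 / 2 : ℝ) • ((curvSphere₁ f t φ + curvSphere₂ f t φ) -
      (curvSphere₁ f t φ - curvSphere₂ f t φ)) := by module
  have d1 := (contDiffOn_curvSphere_add hf ht hφ).differentiableAt_of_isOpen hU hx
  have d2 := (contDiffOn_curvSphere_sub hf ht hφ).differentiableAt_of_isOpen hU hx
  rw [dV, h1, fderiv_const_smul (d1.sub d2), fderiv_sub d1 d2, smul_apply, sub_apply,
    fderiv_curvSphere_add hU hφ H hx, fderiv_curvSphere_sub hU hφ H hx, dV]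
  module

theorem wedge_smul_self (a : R42) (c : ℝ) : wedge a (c • a) = 0 := by
  refine ContinuousLinearMap.ext fun y => ?_
  simp only [wedge_apply, lieForm_smul_left, zero_apply]
  module

/-- From `s₁_u = φ_u s₂` and `s₂_v = φ_v s₁` one gets `s₁_uv = φ_uv s₂ + φ_u φ_v s₁` and the same
with `s₁`, `s₂` exchanged. Hence `s^±_uv = (φ_u φ_v ± φ_uv) s^±`. -/
theorem isOmegaSurface_of_isNullFrame (hU : IsOpen U) (hf : ContDiffOn ℝ ∞ f U)
    (ht : ContDiffOn ℝ ∞ t U) (hφ : ContDiffOn ℝ ∞ φ U)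
    (H : IsNullFrame U e₁ e₂ (t + f) (t - f) α β (fun x => Real.exp (-φ x))
      (fun x => Real.exp (φ x)) θ) :
    IsOmegaSurface U (legendreLift f t) (curvSphere₁ f t φ) (curvSphere₂ f t φ) := by
  have sF : ContDiffOn ℝ ∞ (fun x => qVec + incl (f x)) U :=
    contDiffOn_const.add (inclL.contDiff.comp_contDiffOn hf)
  have sT : ContDiffOn ℝ ∞ (fun x => pVec + incl (t x)) U :=
    contDiffOn_const.add (inclL.contDiff.comp_contDiffOn ht)
  have sc := Real.contDiff_cosh.comp_contDiffOn hφ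
  have ss := Real.contDiff_sinh.comp_contDiffOn hφ
  have s1 : ContDiffOn ℝ ∞ (curvSphere₁ f t φ) U := (sc.smul sT).add (ss.smul sF)
  have s2 : ContDiffOn ℝ ∞ (curvSphere₂ f t φ) U := (ss.smul sT).add (sc.smul sF)
  have dφ : ∀ w, ContDiffOn ℝ ∞ (fun x => fderiv ℝ φ x w) U := fun w =>
    hφ.fderiv_apply_of_isOpen hU w
  have e1 : ∀ x ∈ U, dV (dU (curvSphere₁ f t φ)) x =
      dV (dU φ) x • curvSphere₂ f t φ x + (dU φ x * dV φ x) • curvSphere₁ f t φ x := by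
    intro x hx
    have hd := ((dφ (1, 0)).differentiableAt_of_isOpen hU hx).hasFDerivAt.smul
      (s2.differentiableAt_of_isOpen hU hx).hasFDerivAt
    rw [dV, fderiv_congr_of_isOpen hU (fun x hx => dU_curvSphere₁ hU hf ht hφ H hx) hx]
    refine (congrArg (fun L => L (0, 1)) (HasFDerivAt.fderiv hd)).trans ?_
    simp only [add_apply, smul_apply, ContinuousLinearMap.smulRight_apply]
    change dU φ x • dV (curvSphere₂ f t φ) x + dV (dU φ) x • curvSphere₂ f t φ x = _
    rw [dV_curvSphere₂ hU hf ht hφ H hx]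
    module
  have e2 : ∀ x ∈ U, dV (dU (curvSphere₂ f t φ)) x =
      dV (dU φ) x • curvSphere₁ f t φ x + (dU φ x * dV φ x) • curvSphere₂ f t φ x := by
    intro x hx
    have hd := ((dφ (0, 1)).differentiableAt_of_isOpen hU hx).hasFDerivAt.smul
      (s1.differentiableAt_of_isOpen hU hx).hasFDerivAt
    -- Only the `v` derivative of `s₂` stays in the contact element, so the mixed derivative is
    -- taken in the other order.
    rw [dV_dU_comm hU s2 hx, dU,
      fderiv_congr_of_isOpen hU (fun x hx => dV_curvSphere₂ hU hf ht hφ H hx) hx]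
    refine (congrArg (fun L => L (1, 0)) (HasFDerivAt.fderiv hd)).trans ?_
    simp only [add_apply, smul_apply, ContinuousLinearMap.smulRight_apply]
    change dV φ x • dU (curvSphere₁ f t φ) x + dU (dV φ) x • curvSphere₁ f t φ x = _
    rw [dU_curvSphere₁ hU hf ht hφ H hx, dV_dU_comm hU hφ hx]
    module
  have du1 := s1.fderiv_apply_of_isOpen hU (1, 0)
  have du2 := s2.fderiv_apply_of_isOpen hU (1, 0)
  refine ⟨fun x hx => ?_, fun x hx => ?_, fun x hx => ?_, ⟨s1.add s2, fun x hx => ?_⟩,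
    ⟨s1.sub s2, fun x hx => ?_⟩⟩
  · refine span_pair_eq_of_det_ne_zero (x := Real.sinh (φ x)) (y := Real.cosh (φ x))
      (z := Real.cosh (φ x)) (w := Real.sinh (φ x)) ?_ ?_ ?_
    · rw [curvSphere₁, add_comm]
    · rw [curvSphere₂, add_comm]
    · have := Real.cosh_sq' (φ x)
      nlinarith
  · rw [dU_curvSphere₁ hU hf ht hφ H hx, wedge_smul_self]
  · rw [dV_curvSphere₂ hU hf ht hφ H hx, wedge_smul_self]
  · have h : ∀ x ∈ U, dU (curvSphere₁ f t φ + curvSphere₂ f t φ) x =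
        dU (curvSphere₁ f t φ) x + dU (curvSphere₂ f t φ) x := fun x hx => by
      rw [dU, fderiv_add (s1.differentiableAt_of_isOpen hU hx)
        (s2.differentiableAt_of_isOpen hU hx)]
      rfl
    have h' : dV (dU (curvSphere₁ f t φ + curvSphere₂ f t φ)) x =
        dV (dU (curvSphere₁ f t φ)) x + dV (dU (curvSphere₂ f t φ)) x := by
      rw [dV, fderiv_congr_of_isOpen hU h hx]
      exact congrArg (fun L => L (0, 1)) (fderiv_add (du1.differentiableAt_of_isOpen hU hx)
        (du2.differentiableAt_of_isOpen hU hx))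
    rw [h', e1 x hx, e2 x hx, ← wedge_smul_self _ (dV (dU φ) x + dU φ x * dV φ x)]
    congr 1
    simp only [Pi.add_apply]
    module
  · have h : ∀ x ∈ U, dU (curvSphere₁ f t φ - curvSphere₂ f t φ) x =
        dU (curvSphere₁ f t φ) x - dU (curvSphere₂ f t φ) x := fun x hx => by
      rw [dU, fderiv_sub (s1.differentiableAt_of_isOpen hU hx)
        (s2.differentiableAt_of_isOpen hU hx)]
      rfl
    have h' : dV (dU (curvSphere₁ f t φ - curvSphere₂ f t φ)) x =
        dV (dU (curvSphere₁ f t φ)) x - dV (dU (curvSphere₂ f t φ)) x := by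
      rw [dV, fderiv_congr_of_isOpen hU h hx]
      exact congrArg (fun L => L (0, 1)) (fderiv_sub (du1.differentiableAt_of_isOpen hU hx)
        (du2.differentiableAt_of_isOpen hU hx))
    rw [h', e1 x hx, e2 x hx, ← wedge_smul_self _ (dU φ x * dV φ x - dV (dU φ) x)]
    congr 1
    simp only [Pi.sub_apply]
    module

end Moutard

/-! ## Gauge transformation of the Calapso forms -/

theorem IsLieIsometry.comp {A B : R42 →L[ℝ] R42} (hA : IsLieIsometry A) (hB : IsLieIsometry B) :
    IsLieIsometry (A.comp B) := fun x y => by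
  rw [ContinuousLinearMap.comp_apply, ContinuousLinearMap.comp_apply, hA, hB]

/-- For isotropic span the skew map `a ∧ b` squares to zero, so this is the exponential of `c a ∧
b`. -/
theorem isLieIsometry_one_add_wedge {a b : R42} (haa : lieForm a a = 0) (hab : lieForm a b = 0)
    (hbb : lieForm b b = 0) (c : ℝ) :
    IsLieIsometry (ContinuousLinearMap.id ℝ R42 + c • wedge a b) := by
  intro x y
  simp only [add_apply, smul_apply, ContinuousLinearMap.id_apply, wedge_apply, lieForm_add_left,
    lieForm_add_right, lieForm_sub_left, lieForm_sub_right, lieForm_smul_left,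
    lieForm_smul_right, haa, hab, hbb, lieForm_comm b a, lieForm_comm x a, lieForm_comm x b]
  ring

/-- This is the gauge equation `λ τ⁺ B + dB = B ω` for `B = 1 + (λ/2) s⁺ ∧ s⁻`, evaluated at `y`.
Here `k` and `k'` stand for `dφ` and `⋆dφ`: `k'` drops out because `s⁺ ∧ s⁺ = 0`, and `k` because
`s⁺` and `s⁻` scale inversely. -/
theorem wedge_gauge {s₁ s₂ E₁ E₂ : R42} (h11 : lieForm s₁ s₁ = 0) (h12 : lieForm s₁ s₂ = 0)
    (h22 : lieForm s₂ s₂ = 0) (hE11 : lieForm s₁ E₁ = 0) (hE12 : lieForm s₁ E₂ = 0)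
    (hE21 : lieForm s₂ E₁ = 0) (hE22 : lieForm s₂ E₂ = 0) (lam k k' a b : ℝ) (y : R42) :
    (lam • wedge (s₁ + s₂) (k' • (s₁ + s₂) + a • E₁ + (-b) • E₂))
        (y + (lam / 2) • wedge (s₁ + s₂) (s₁ - s₂) y) +
      (lam / 2) • (wedge (s₁ + s₂) (-k • (s₁ - s₂) - a • E₁ + b • E₂) y +
        wedge (k • (s₁ + s₂) + a • E₁ + b • E₂) (s₁ - s₂) y) =
      (lam • (a • wedge s₂ E₁ - b • wedge s₁ E₂)) y + (lam / 2) • wedge (s₁ + s₂) (s₁ - s₂)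
        ((lam • (a • wedge s₂ E₁ - b • wedge s₁ E₂)) y) := by
  simp only [sub_apply, smul_apply, wedge_apply, lieForm_add_left, lieForm_add_right,
    lieForm_sub_left, lieForm_sub_right, lieForm_smul_left, lieForm_smul_right, h11, h12, h22,
    hE11, hE12, hE21, hE22, lieForm_comm s₂ s₁, lieForm_comm E₁ s₁, lieForm_comm E₁ s₂,
    lieForm_comm E₂ s₁, lieForm_comm E₂ s₂]
  module

/-- The connection form `λ (s₂ ∧ a du - s₁ ∧ b dv)` of a Lie geometric deformation. -/
noncomputable def deformationForm (s₁ s₂ : ℝ × ℝ → R42) (e₁ e₂ : ℝ × ℝ → R31)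
    (α β : ℝ × ℝ → ℝ) (lam : ℝ) (x w : ℝ × ℝ) : R42 →L[ℝ] R42 :=
  lam • ((α x * w.1) • wedge (s₂ x) (incl (e₁ x)) - (β x * w.2) • wedge (s₁ x) (incl (e₂ x)))

/-- `M` integrates the connection form of a Lie geometric deformation. -/
structure IsDeformation (U : Set (ℝ × ℝ)) (s₁ s₂ : ℝ × ℝ → R42) (e₁ e₂ : ℝ × ℝ → R31)
    (α β : ℝ × ℝ → ℝ) (lam : ℝ) (M : ℝ × ℝ → R42 →L[ℝ] R42) : Prop where
  smooth : ContDiffOn ℝ ∞ M U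
  isometry : ∀ x ∈ U, IsLieIsometry (M x)
  deriv_eq : ∀ x ∈ U, ∀ w,
    fderiv ℝ M x w = (M x).comp (deformationForm s₁ s₂ e₁ e₂ α β lam x w)

/-! ### Pairings with the null basis `q^±` of `ℝ^{1,1}` -/

section Pairings

theorem lieForm_qPlus_qPlus : lieForm qPlus qPlus = 0 := by
  rw [lieForm_qPlus]; simp [qPlus, pVec, qVec]
theorem lieForm_qPlus_qMinus : lieForm qPlus qMinus = -2 := by
  rw [lieForm_qMinus]; simp [qPlus, pVec, qVec]; norm_num
theorem lieForm_qMinus_qMinus : lieForm qMinus qMinus = 0 := by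
  rw [lieForm_qMinus]; simp [qMinus, pVec, qVec]
theorem lieForm_qMinus_qPlus : lieForm qMinus qPlus = -2 := by
  rw [lieForm_comm, lieForm_qPlus_qMinus]
theorem lieForm_incl_qPlus (a : R31) : lieForm (incl a) qPlus = 0 := by
  rw [lieForm_qPlus]; simp [incl]
theorem lieForm_incl_qMinus (a : R31) : lieForm (incl a) qMinus = 0 := by
  rw [lieForm_qMinus]; simp [incl]
theorem lieForm_qPlus_incl (a : R31) : lieForm qPlus (incl a) = 0 := by
  rw [lieForm_comm, lieForm_incl_qPlus]
theorem lieForm_qMinus_incl (a : R31) : lieForm qMinus (incl a) = 0 := by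
  rw [lieForm_comm, lieForm_incl_qMinus]

theorem eq_incl_of_lieForm {z : R42} (h1 : lieForm z qPlus = 0) (h2 : lieForm z qMinus = 0) :
    z = incl z.2 := by
  rw [lieForm_qPlus] at h1
  rw [lieForm_qMinus] at h2
  exact Prod.ext (Prod.ext (by simp [incl]; linarith) (by simp [incl]; linarith)) rfl

theorem eq_qPlus_add_of_lieForm {z : R42} (h1 : lieForm z qPlus = 0)
    (h2 : lieForm z qMinus = -2) : z = qPlus + incl z.2 := by
  rw [lieForm_qPlus] at h1
  rw [lieForm_qMinus] at h2
  refine Prod.ext (Prod.ext ?_ ?_) ?_ <;> simp [incl, qPlus, pVec, qVec] <;> linarith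

theorem eq_qMinus_add_of_lieForm {z : R42} (h1 : lieForm z qPlus = -2)
    (h2 : lieForm z qMinus = 0) : z = qMinus + incl z.2 := by
  rw [lieForm_qPlus] at h1
  rw [lieForm_qMinus] at h2
  refine Prod.ext (Prod.ext ?_ ?_) ?_ <;> simp [incl, qMinus, pVec, qVec] <;> linarith

variable {U : Set (ℝ × ℝ)} {e₁ e₂ g h : ℝ × ℝ → R31} {α β ξ η : ℝ × ℝ → ℝ}
  {θ : ℝ × ℝ → ℝ × ℝ → ℝ}

theorem lieForm_liftPlus_qPlus (g : ℝ × ℝ → R31) (x : ℝ × ℝ) :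
    lieForm (liftPlus g x) qPlus = 0 := by
  rw [liftPlus, lieForm_add_left, lieForm_qPlus_qPlus, lieForm_incl_qPlus, add_zero]
theorem lieForm_liftPlus_qMinus (g : ℝ × ℝ → R31) (x : ℝ × ℝ) :
    lieForm (liftPlus g x) qMinus = -2 := by
  rw [liftPlus, lieForm_add_left, lieForm_qPlus_qMinus, lieForm_incl_qMinus, add_zero]
theorem lieForm_liftMinus_qPlus (h : ℝ × ℝ → R31) (x : ℝ × ℝ) :
    lieForm (liftMinus h x) qPlus = -2 := by
  rw [liftMinus, lieForm_add_left, lieForm_qMinus_qPlus, lieForm_incl_qPlus, add_zero]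
theorem lieForm_liftMinus_qMinus (h : ℝ × ℝ → R31) (x : ℝ × ℝ) :
    lieForm (liftMinus h x) qMinus = 0 := by
  rw [liftMinus, lieForm_add_left, lieForm_qMinus_qMinus, lieForm_incl_qMinus, add_zero]
theorem lieForm_liftPlus_incl (g : ℝ × ℝ → R31) (x : ℝ × ℝ) (a : R31) :
    lieForm (liftPlus g x) (incl a) = mink (g x) a := by
  rw [liftPlus, lieForm_add_left, lieForm_qPlus_incl, lieForm_incl, zero_add]
theorem lieForm_liftMinus_incl (h : ℝ × ℝ → R31) (x : ℝ × ℝ) (a : R31) :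
    lieForm (liftMinus h x) (incl a) = mink (h x) a := by
  rw [liftMinus, lieForm_add_left, lieForm_qMinus_incl, lieForm_incl, zero_add]
theorem lieForm_liftPlus_liftPlus (g g' : ℝ × ℝ → R31) (x : ℝ × ℝ) :
    lieForm (liftPlus g x) (liftPlus g' x) = mink (g x) (g' x) := by
  rw [liftPlus.eq_def g', lieForm_add_right, lieForm_liftPlus_qPlus, lieForm_liftPlus_incl,
    zero_add]
theorem lieForm_liftPlus_liftMinus (g h : ℝ × ℝ → R31) (x : ℝ × ℝ) :
    lieForm (liftPlus g x) (liftMinus h x) = mink (g x) (h x) - 2 := by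
  rw [liftMinus.eq_def h, lieForm_add_right, lieForm_liftPlus_qMinus, lieForm_liftPlus_incl]
  ring
theorem lieForm_liftMinus_liftMinus (h h' : ℝ × ℝ → R31) (x : ℝ × ℝ) :
    lieForm (liftMinus h x) (liftMinus h' x) = mink (h x) (h' x) := by
  rw [liftMinus.eq_def h', lieForm_add_right, lieForm_liftMinus_qMinus, lieForm_liftMinus_incl,
    zero_add]

end Pairings

/-! ### Curvature spheres and `p^±` in terms of the lifted Gauss maps -/

theorem curvSphere₁_eq (f t : ℝ × ℝ → R31) (φ : ℝ × ℝ → ℝ) (x : ℝ × ℝ) :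
    curvSphere₁ f t φ x = (Real.exp (φ x) / 2) • liftPlus (t + f) x +
      (Real.exp (-φ x) / 2) • liftMinus (t - f) x := by
  have h : curvSphere₁ f t φ x = (1 / 2 : ℝ) • ((curvSphere₁ f t φ x + curvSphere₂ f t φ x) +
      (curvSphere₁ f t φ x - curvSphere₂ f t φ x)) := by module
  rw [h, curvSphere_add, curvSphere_sub]
  module

theorem curvSphere₂_eq (f t : ℝ × ℝ → R31) (φ : ℝ × ℝ → ℝ) (x : ℝ × ℝ) :
    curvSphere₂ f t φ x = (Real.exp (φ x) / 2) • liftPlus (t + f) x -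
      (Real.exp (-φ x) / 2) • liftMinus (t - f) x := by
  have h : curvSphere₂ f t φ x = (1 / 2 : ℝ) • ((curvSphere₁ f t φ x + curvSphere₂ f t φ x) -
      (curvSphere₁ f t φ x - curvSphere₂ f t φ x)) := by module
  rw [h, curvSphere_add, curvSphere_sub]
  module

/-- `(q⁺, s⁻) = -2 e^{-φ}` cancels the factor `e^{φ}` of `s⁺`, so `p⁺` does not involve `φ`. -/
theorem pPlus_eq (f t : ℝ × ℝ → R31) (φ : ℝ × ℝ → ℝ) (lam : ℝ) (x : ℝ × ℝ) :
    pPlus (curvSphere₁ f t φ) (curvSphere₂ f t φ) lam x = qPlus - lam • liftPlus (t + f) x := by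
  have := (Real.exp_pos (φ x)).ne'
  rw [pPlus, curvSphere_add, curvSphere_sub, lieForm_smul_right, lieForm_comm,
    lieForm_liftMinus_qPlus, Real.exp_neg]
  match_scalars <;> field_simp

theorem pMinus_eq (f t : ℝ × ℝ → R31) (φ : ℝ × ℝ → ℝ) (lam : ℝ) (x : ℝ × ℝ) :
    pMinus (curvSphere₁ f t φ) (curvSphere₂ f t φ) lam x = qMinus - lam • liftMinus (t - f) x := by
  have := (Real.exp_pos (φ x)).ne'
  rw [pMinus, curvSphere_add, curvSphere_sub, lieForm_smul_right, lieForm_comm,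
    lieForm_liftPlus_qMinus, Real.exp_neg]
  match_scalars <;> field_simp

/-! ### The connection form of the deformation and its conserved quantities -/

section Deformation

variable {U : Set (ℝ × ℝ)} {f t e₁ e₂ : ℝ × ℝ → R31} {φ α β : ℝ × ℝ → ℝ}
  {θ : ℝ × ℝ → ℝ × ℝ → ℝ} {lam : ℝ} {T M : ℝ × ℝ → R42 →L[ℝ] R42}

/-- Differentiate `T = T⁺ (1 + (λ/2) s⁺ ∧ s⁻)` and apply `wedge_gauge`: the span of `s₁`, `s₂` is
totally isotropic and orthogonal to `e₁`, `e₂`. -/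
theorem isDeformation_of_isLieDeformation (hU : IsOpen U) (hf : ContDiffOn ℝ ∞ f U)
    (ht : ContDiffOn ℝ ∞ t U) (hφ : ContDiffOn ℝ ∞ φ U)
    (H : IsNullFrame U e₁ e₂ (t + f) (t - f) α β (fun x => Real.exp (-φ x))
      (fun x => Real.exp (φ x)) θ)
    (hT : IsLieDeformation U (curvSphere₁ f t φ) (curvSphere₂ f t φ) lam T) :
    IsDeformation U (curvSphere₁ f t φ) (curvSphere₂ f t φ) e₁ e₂ α β lam T := by
  obtain ⟨Tp, _, hTp, _, hTeq⟩ := hT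
  have gPP : ∀ x ∈ U, lieForm (liftPlus (t + f) x) (liftPlus (t + f) x) = 0 := fun x hx => by
    rw [lieForm_liftPlus_liftPlus, H.inner_g_g hx]
  have gPM : ∀ x ∈ U, lieForm (liftPlus (t + f) x) (liftMinus (t - f) x) = 0 := fun x hx => by
    rw [lieForm_liftPlus_liftMinus, H.inner_g_h hx, sub_self]
  have gMM : ∀ x ∈ U, lieForm (liftMinus (t - f) x) (liftMinus (t - f) x) = 0 := fun x hx => by
    rw [lieForm_liftMinus_liftMinus, H.inner_h_h hx]
  have smoothP := contDiffOn_curvSphere_add hf ht hφ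
  have smoothM := contDiffOn_curvSphere_sub hf ht hφ
  have hTB : ∀ x ∈ U, T x = (Tp x).comp (ContinuousLinearMap.id ℝ R42 + (lam / 2) •
      wedgeL ((curvSphere₁ f t φ + curvSphere₂ f t φ) x)
        ((curvSphere₁ f t φ - curvSphere₂ f t φ) x)) := fun x hx => (hTeq x hx).1
  refine ⟨?_, fun x hx => ?_, fun x hx w => ?_⟩
  · refine ContDiffOn.congr ?_ hTB
    exact hTp.smooth.clm_comp (contDiffOn_const.add
      (((wedgeL.contDiff.comp_contDiffOn smoothP).clm_apply smoothM).const_smul _))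
  · rw [(hTeq x hx).1]
    refine (hTp.isometry x hx).comp (isLieIsometry_one_add_wedge ?_ ?_ ?_ _)
    · rw [curvSphere_add, lieForm_smul_left, lieForm_smul_right, gPP x hx]; ring
    · rw [curvSphere_add, curvSphere_sub, lieForm_smul_left, lieForm_smul_right, gPM x hx]; ring
    · rw [curvSphere_sub, lieForm_smul_left, lieForm_smul_right, gMM x hx]; ring
  · have dP := (smoothP.differentiableAt_of_isOpen hU hx).hasFDerivAt
    have dM := (smoothM.differentiableAt_of_isOpen hU hx).hasFDerivAt
    have dTp := (hTp.smooth.differentiableAt_of_isOpen hU hx).hasFDerivAt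
    have dB := ((wedgeL.hasFDerivAt_of_bilinear dP dM).const_smul (lam / 2)).const_add
      (ContinuousLinearMap.id ℝ R42)
    rw [fderiv_congr_of_isOpen hU hTB hx, hTB x hx]
    refine (congrArg (fun L => L w) (HasFDerivAt.fderiv (dTp.clm_comp dB))).trans ?_
    refine ContinuousLinearMap.ext fun y => ?_
    have hcalapso : calapsoForm (curvSphere₁ f t φ + curvSphere₂ f t φ) x w =
        wedge (curvSphere₁ f t φ x + curvSphere₂ f t φ x)
          (fderiv ℝ φ x (w.1, -w.2) • (curvSphere₁ f t φ x + curvSphere₂ f t φ x) +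
          (α x * w.1) • incl (e₁ x) + (-(β x * w.2)) • incl (e₂ x)) := by
      rw [calapsoForm, fderiv_curvSphere_add hU hφ H hx, mul_neg]
      rfl
    simp only [add_apply, smul_apply, ContinuousLinearMap.comp_apply,
      ContinuousLinearMap.compL_apply, ContinuousLinearMap.flip_apply,
      ContinuousLinearMap.precompR_apply, ContinuousLinearMap.precompL_apply,
      ContinuousLinearMap.id_apply, hTp.deriv_eq x hx, hcalapso, wedgeL_apply,
      fderiv_curvSphere_add hU hφ H hx, fderiv_curvSphere_sub hU hφ H hx, Pi.add_apply,
      Pi.sub_apply, deformationForm]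
    have e1g : mink ((t + f) x) (e₁ x) = 0 := by rw [mink_comm, H.inner_e₁_g hx]
    have e1h : mink ((t - f) x) (e₁ x) = 0 := by rw [mink_comm, H.inner_e₁_h hx]
    have e2g : mink ((t + f) x) (e₂ x) = 0 := by rw [mink_comm, H.inner_e₂_g hx]
    have e2h : mink ((t - f) x) (e₂ x) = 0 := by rw [mink_comm, H.inner_e₂_h hx]
    rw [← map_add, add_comm]
    refine congrArg (Tp x) (wedge_gauge ?_ ?_ ?_ ?_ ?_ ?_ ?_ lam _ _ _ _ y) <;>
    simp only [curvSphere₁_eq, curvSphere₂_eq, lieForm_add_left, lieForm_add_right,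
      lieForm_sub_left, lieForm_sub_right, lieForm_smul_left, lieForm_smul_right, gPP x hx,
      gPM x hx, gMM x hx, lieForm_comm (liftMinus (t - f) x) (liftPlus (t + f) x),
      lieForm_liftPlus_incl, lieForm_liftMinus_incl, e1g, e1h, e2g, e2h, mul_zero, add_zero,
      sub_zero]

/-- This is the freedom of the constants of integration: `T⁻¹ dT` ignores constant left factors. -/
theorem IsDeformation.postcomp (hU : IsOpen U) {s₁ s₂ : ℝ × ℝ → R42}
    (hT : IsDeformation U s₁ s₂ e₁ e₂ α β lam T) {A : R42 →L[ℝ] R42} (hA : IsLieIsometry A) :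
    IsDeformation U s₁ s₂ e₁ e₂ α β lam (fun x => A.comp (T x)) where
  smooth := contDiffOn_const.clm_comp hT.smooth
  isometry x hx := hA.comp (hT.isometry x hx)
  deriv_eq x hx w := by
    have h := (hasFDerivAt_const A x).clm_comp
      (hT.smooth.differentiableAt_of_isOpen hU hx).hasFDerivAt
    rw [h.fderiv]
    refine ContinuousLinearMap.ext fun y => ?_
    simp [hT.deriv_eq x hx]

theorem IsDeformation.hasFDerivAt_apply {s₁ s₂ : ℝ × ℝ → R42} (hU : IsOpen U)
    (hM : IsDeformation U s₁ s₂ e₁ e₂ α β lam M) {x : ℝ × ℝ} (hx : x ∈ U)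
    {y : ℝ × ℝ → R42} {y' : ℝ × ℝ →L[ℝ] R42} (hy : HasFDerivAt y y' x) (w : ℝ × ℝ) :
    fderiv ℝ (fun z => M z (y z)) x w =
      M x (deformationForm s₁ s₂ e₁ e₂ α β lam x w (y x) + y' w) := by
  rw [((hM.smooth.differentiableAt_of_isOpen hU hx).hasFDerivAt.clm_apply hy).fderiv]
  simp [hM.deriv_eq x hx, add_comm]

/-- The vector lies in the isotropic contact element and is orthogonal to `e₁`, `e₂`, so each wedge
kills it. Consequently `d(T (q⁺ + g)) = T dg`. -/
theorem deformationForm_apply_liftPlus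
    (H : IsNullFrame U e₁ e₂ (t + f) (t - f) α β (fun x => Real.exp (-φ x))
      (fun x => Real.exp (φ x)) θ) {x : ℝ × ℝ} (hx : x ∈ U) (w : ℝ × ℝ) :
    deformationForm (curvSphere₁ f t φ) (curvSphere₂ f t φ) e₁ e₂ α β lam x w
      (liftPlus (t + f) x) = 0 := by
  simp only [deformationForm, smul_apply, sub_apply, wedge_apply, curvSphere₁_eq, curvSphere₂_eq,
    lieForm_add_left, lieForm_sub_left, lieForm_smul_left, lieForm_liftPlus_liftPlus,
    H.inner_g_g hx, lieForm_comm (liftMinus (t - f) x) (liftPlus (t + f) x),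
    lieForm_liftPlus_liftMinus, H.inner_g_h hx, lieForm_comm (incl _) (liftPlus (t + f) x),
    lieForm_liftPlus_incl, mink_comm _ (e₁ x), mink_comm _ (e₂ x), H.inner_e₁_g hx,
    H.inner_e₂_g hx]
  module

theorem deformationForm_apply_liftMinus
    (H : IsNullFrame U e₁ e₂ (t + f) (t - f) α β (fun x => Real.exp (-φ x))
      (fun x => Real.exp (φ x)) θ) {x : ℝ × ℝ} (hx : x ∈ U) (w : ℝ × ℝ) :
    deformationForm (curvSphere₁ f t φ) (curvSphere₂ f t φ) e₁ e₂ α β lam x w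
      (liftMinus (t - f) x) = 0 := by
  simp only [deformationForm, smul_apply, sub_apply, wedge_apply, curvSphere₁_eq, curvSphere₂_eq,
    lieForm_add_left, lieForm_sub_left, lieForm_smul_left, lieForm_liftMinus_liftMinus,
    H.inner_h_h hx, lieForm_liftPlus_liftMinus, H.inner_g_h hx,
    lieForm_comm (incl _) (liftMinus (t - f) x),
    lieForm_liftMinus_incl, mink_comm _ (e₁ x), mink_comm _ (e₂ x), H.inner_e₁_h hx,
    H.inner_e₂_h hx]
  module

/-- For a null frame of the front, the right side is `λ dg`. -/
theorem deformationForm_apply_qPlus (x w : ℝ × ℝ) :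
    deformationForm (curvSphere₁ f t φ) (curvSphere₂ f t φ) e₁ e₂ α β lam x w qPlus =
      (lam * Real.exp (-φ x)) • ((α x * w.1) • incl (e₁ x) + (β x * w.2) • incl (e₂ x)) := by
  simp only [deformationForm, smul_apply, sub_apply, wedge_apply, curvSphere₁_eq, curvSphere₂_eq,
    lieForm_add_left, lieForm_sub_left, lieForm_smul_left, lieForm_liftPlus_qPlus,
    lieForm_liftMinus_qPlus, lieForm_incl_qPlus]
  module

theorem deformationForm_apply_qMinus (x w : ℝ × ℝ) :
    deformationForm (curvSphere₁ f t φ) (curvSphere₂ f t φ) e₁ e₂ α β lam x w qMinus =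
      (lam * Real.exp (φ x)) • (-(α x * w.1) • incl (e₁ x) + (β x * w.2) • incl (e₂ x)) := by
  simp only [deformationForm, smul_apply, sub_apply, wedge_apply, curvSphere₁_eq, curvSphere₂_eq,
    lieForm_add_left, lieForm_sub_left, lieForm_smul_left, lieForm_liftPlus_qMinus,
    lieForm_liftMinus_qMinus, lieForm_incl_qMinus]
  module

/-- `M p⁺` is constant. -/
theorem IsDeformation.exists_apply_pPlus_eq (hU : IsOpen U) (hUc : IsPreconnected U)
    (H : IsNullFrame U e₁ e₂ (t + f) (t - f) α β (fun x => Real.exp (-φ x))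
      (fun x => Real.exp (φ x)) θ)
    (hM : IsDeformation U (curvSphere₁ f t φ) (curvSphere₂ f t φ) e₁ e₂ α β lam M) :
    ∃ P, ∀ x ∈ U, M x (pPlus (curvSphere₁ f t φ) (curvSphere₂ f t φ) lam x) = P := by
  simp only [pPlus_eq]
  have hd : ∀ x ∈ U, HasFDerivAt (fun x => qPlus - lam • liftPlus (t + f) x)
      (-(lam • inclL.comp (fderiv ℝ (t + f) x))) x := fun x hx =>
    ((hasFDerivAt_liftPlus (H.smooth_g.differentiableAt_of_isOpen hU hx)).const_smul
      lam).const_sub _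
  refine hU.exists_is_const_of_fderiv_eq_zero (𝕜 := ℝ) hUc (fun x hx => ?_) (fun x hx => ?_)
  · exact ((hM.smooth.differentiableAt_of_isOpen hU hx).clm_apply
      (hd x hx).differentiableAt).differentiableWithinAt
  -- The connection form contributes `λ dg` through `q⁺`, and differentiating `-λ (q⁺ + g)`
  -- contributes `-λ dg`.
  · refine ContinuousLinearMap.ext fun w => ?_
    rw [hM.hasFDerivAt_apply hU hx (hd x hx), map_sub, map_smul,
      deformationForm_apply_liftPlus H hx, deformationForm_apply_qPlus]
    simp only [neg_apply, smul_apply, ContinuousLinearMap.comp_apply, H.fderiv_g x hx, map_add,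
      map_smul, map_neg, inclL_apply, Pi.zero_apply, zero_apply, smul_zero, sub_zero]
    module

/-- `M p⁻` is constant. -/
theorem IsDeformation.exists_apply_pMinus_eq (hU : IsOpen U) (hUc : IsPreconnected U)
    (H : IsNullFrame U e₁ e₂ (t + f) (t - f) α β (fun x => Real.exp (-φ x))
      (fun x => Real.exp (φ x)) θ)
    (hM : IsDeformation U (curvSphere₁ f t φ) (curvSphere₂ f t φ) e₁ e₂ α β lam M) :
    ∃ P, ∀ x ∈ U, M x (pMinus (curvSphere₁ f t φ) (curvSphere₂ f t φ) lam x) = P := by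
  simp only [pMinus_eq]
  have hd : ∀ x ∈ U, HasFDerivAt (fun x => qMinus - lam • liftMinus (t - f) x)
      (-(lam • inclL.comp (fderiv ℝ (t - f) x))) x := fun x hx =>
    ((hasFDerivAt_liftMinus (H.smooth_h.differentiableAt_of_isOpen hU hx)).const_smul
      lam).const_sub _
  refine hU.exists_is_const_of_fderiv_eq_zero (𝕜 := ℝ) hUc (fun x hx => ?_) (fun x hx => ?_)
  · exact ((hM.smooth.differentiableAt_of_isOpen hU hx).clm_apply
      (hd x hx).differentiableAt).differentiableWithinAt
  · refine ContinuousLinearMap.ext fun w => ?_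
    rw [hM.hasFDerivAt_apply hU hx (hd x hx), map_sub, map_smul,
      deformationForm_apply_liftMinus H hx, deformationForm_apply_qMinus]
    simp only [neg_apply, smul_apply, ContinuousLinearMap.comp_apply, H.fderiv_h x hx, map_add,
      map_smul, map_neg, inclL_apply, Pi.zero_apply, zero_apply, smul_zero, sub_zero]
    module

theorem lieForm_pPlus_pPlus
    (H : IsNullFrame U e₁ e₂ (t + f) (t - f) α β (fun x => Real.exp (-φ x))
      (fun x => Real.exp (φ x)) θ) (lam : ℝ) {x : ℝ × ℝ} (hx : x ∈ U) :
    lieForm (pPlus (curvSphere₁ f t φ) (curvSphere₂ f t φ) lam x)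
      (pPlus (curvSphere₁ f t φ) (curvSphere₂ f t φ) lam x) = 0 := by
  simp only [pPlus_eq, lieForm_sub_left, lieForm_sub_right, lieForm_smul_left,
    lieForm_smul_right, lieForm_qPlus_qPlus, lieForm_comm qPlus (liftPlus (t + f) x),
    lieForm_liftPlus_qPlus, lieForm_liftPlus_liftPlus, H.inner_g_g hx]
  ring

theorem lieForm_pMinus_pMinus
    (H : IsNullFrame U e₁ e₂ (t + f) (t - f) α β (fun x => Real.exp (-φ x))
      (fun x => Real.exp (φ x)) θ) (lam : ℝ) {x : ℝ × ℝ} (hx : x ∈ U) :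
    lieForm (pMinus (curvSphere₁ f t φ) (curvSphere₂ f t φ) lam x)
      (pMinus (curvSphere₁ f t φ) (curvSphere₂ f t φ) lam x) = 0 := by
  simp only [pMinus_eq, lieForm_sub_left, lieForm_sub_right, lieForm_smul_left,
    lieForm_smul_right, lieForm_qMinus_qMinus, lieForm_comm qMinus (liftMinus (t - f) x),
    lieForm_liftMinus_qMinus, lieForm_liftMinus_liftMinus, H.inner_h_h hx]
  ring

/-- The value `λ = 1/2` is excluded because there `p⁺` and `p⁻` become orthogonal. The factor `1 -
2λ` reappears as the square of the spectral parameter. -/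
theorem lieForm_pPlus_pMinus
    (H : IsNullFrame U e₁ e₂ (t + f) (t - f) α β (fun x => Real.exp (-φ x))
      (fun x => Real.exp (φ x)) θ) (lam : ℝ) {x : ℝ × ℝ} (hx : x ∈ U) :
    lieForm (pPlus (curvSphere₁ f t φ) (curvSphere₂ f t φ) lam x)
      (pMinus (curvSphere₁ f t φ) (curvSphere₂ f t φ) lam x) = -2 * (1 - 2 * lam) := by
  simp only [pPlus_eq, pMinus_eq, lieForm_sub_left, lieForm_sub_right, lieForm_smul_left,
    lieForm_smul_right, lieForm_qPlus_qMinus, lieForm_comm qPlus (liftMinus (t - f) x),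
    lieForm_liftMinus_qPlus, lieForm_liftPlus_qMinus, lieForm_liftPlus_liftMinus,
    H.inner_g_h hx]
  ring

end Deformation

/-! ## The deformed front -/

section DeformedFront

variable {U : Set (ℝ × ℝ)} {f t e₁ e₂ : ℝ × ℝ → R31} {φ α β : ℝ × ℝ → ℝ}
  {θ : ℝ × ℝ → ℝ × ℝ → ℝ} {lam : ℝ} {M : ℝ × ℝ → R42 →L[ℝ] R42}

/-- The `ℝ^{3,1}`-component as a continuous linear map. -/
noncomputable def sndL : R42 →L[ℝ] R31 := ContinuousLinearMap.snd ℝ (ℝ × ℝ) R31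

theorem legendreLift_half (g h : ℝ × ℝ → R31) (x : ℝ × ℝ) :
    legendreLift ((1 / 2 : ℝ) • (g - h)) ((1 / 2 : ℝ) • (g + h)) x =
      Submodule.span ℝ {liftPlus g x, liftMinus h x} := by
  refine span_pair_eq_of_det_ne_zero (x := 1 / 2) (y := -1 / 2) (z := 1 / 2) (w := 1 / 2)
    ?_ ?_ (by norm_num)
  · simp only [liftPlus, liftMinus, qPlus, qMinus, ← inclL_apply, Pi.smul_apply, Pi.sub_apply,
      map_smul, map_sub]
    module
  · simp only [liftPlus, liftMinus, qPlus, qMinus, ← inclL_apply, Pi.smul_apply, Pi.add_apply,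
      map_smul, map_add]
    module

/-- The components of the images of an adapted frame under a normalized deformation form the
frame of the deformed front. -/
theorem IsDeformation.exists_isNullFrame (hU : IsOpen U)
    (H : IsNullFrame U e₁ e₂ (t + f) (t - f) α β (fun x => Real.exp (-φ x))
      (fun x => Real.exp (φ x)) θ)
    (hM : IsDeformation U (curvSphere₁ f t φ) (curvSphere₂ f t φ) e₁ e₂ α β lam M)
    {c d : ℝ} (hcd0 : c * d ≠ 0)
    (hp : ∀ x ∈ U, M x (pPlus (curvSphere₁ f t φ) (curvSphere₂ f t φ) lam x) = d • qPlus)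
    (hm : ∀ x ∈ U, M x (pMinus (curvSphere₁ f t φ) (curvSphere₂ f t φ) lam x) = c • qMinus) :
    ∃ e₁' e₂' g h : ℝ × ℝ → R31,
      IsNullFrame U e₁' e₂' g h α β (fun x => c * Real.exp (-φ x))
        (fun x => d * Real.exp (φ x)) θ ∧
      MapsFront U M f t ((1 / 2 : ℝ) • (g - h)) ((1 / 2 : ℝ) • (g + h)) := by
  have hc : c ≠ 0 := left_ne_zero_of_mul hcd0
  have hd : d ≠ 0 := right_ne_zero_of_mul hcd0
  -- As `M` is an isometry with `M p⁺ = d q⁺` and `M p⁻ = c q⁻`, the `ℝ^{1,1}` component of `M y` is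
  -- determined by the pairings of `y` with `p^±`.
  have hqp : ∀ x ∈ U, ∀ y, lieForm (M x y) qPlus =
      d⁻¹ * lieForm y (pPlus (curvSphere₁ f t φ) (curvSphere₂ f t φ) lam x) := by
    intro x hx y
    rw [← hM.isometry x hx y, hp x hx, lieForm_smul_right]
    field_simp
  have hqm : ∀ x ∈ U, ∀ y, lieForm (M x y) qMinus =
      c⁻¹ * lieForm y (pMinus (curvSphere₁ f t φ) (curvSphere₂ f t φ) lam x) := by
    intro x hx y
    rw [← hM.isometry x hx y, hm x hx, lieForm_smul_right]
    field_simp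
  have hE : ∀ x ∈ U, ∀ a : R31, mink a (t x + f x) = 0 → mink a (t x - f x) = 0 →
      M x (incl a) = incl (M x (incl a)).2 := by
    intro x hx a h1 h2
    refine eq_incl_of_lieForm ?_ ?_
    · rw [hqp x hx, pPlus_eq, lieForm_sub_right, lieForm_smul_right, lieForm_incl_qPlus,
        lieForm_comm, lieForm_liftPlus_incl, mink_comm, Pi.add_apply, h1]
      ring
    · rw [hqm x hx, pMinus_eq, lieForm_sub_right, lieForm_smul_right, lieForm_incl_qMinus,
        lieForm_comm, lieForm_liftMinus_incl, mink_comm, Pi.sub_apply, h2]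
      ring
  have hE1 : ∀ x ∈ U, M x (incl (e₁ x)) = incl (M x (incl (e₁ x))).2 := fun x hx =>
    hE x hx _ (H.inner_e₁_g hx) (H.inner_e₁_h hx)
  have hE2 : ∀ x ∈ U, M x (incl (e₂ x)) = incl (M x (incl (e₂ x))).2 := fun x hx =>
    hE x hx _ (H.inner_e₂_g hx) (H.inner_e₂_h hx)
  obtain ⟨g, hg⟩ : ∃ g : ℝ × ℝ → R31, g = fun x => c • (M x (liftPlus (t + f) x)).2 := ⟨_, rfl⟩
  obtain ⟨h, hh⟩ : ∃ h : ℝ × ℝ → R31, h = fun x => d • (M x (liftMinus (t - f) x)).2 := ⟨_, rfl⟩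
  -- The factor `c` normalizes the product with `q⁻` to `-2`: `(q⁺ + g, p⁻) = -2`, and `M`
  -- contributes `c⁻¹`.
  have hG : ∀ x ∈ U, c • M x (liftPlus (t + f) x) = liftPlus g x := by
    intro x hx
    rw [liftPlus.eq_def g, hg]
    refine eq_qPlus_add_of_lieForm ?_ ?_
    · rw [lieForm_smul_left, hqp x hx, pPlus_eq, lieForm_sub_right, lieForm_smul_right,
        lieForm_liftPlus_qPlus, lieForm_liftPlus_liftPlus, H.inner_g_g hx]
      ring
    · rw [lieForm_smul_left, hqm x hx, pMinus_eq, lieForm_sub_right, lieForm_smul_right,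
        lieForm_liftPlus_qMinus, lieForm_liftPlus_liftMinus, H.inner_g_h hx]
      field_simp
      ring
  have hH : ∀ x ∈ U, d • M x (liftMinus (t - f) x) = liftMinus h x := by
    intro x hx
    rw [liftMinus.eq_def h, hh]
    refine eq_qMinus_add_of_lieForm ?_ ?_
    · rw [lieForm_smul_left, hqp x hx, pPlus_eq, lieForm_sub_right, lieForm_smul_right,
        lieForm_liftMinus_qPlus, lieForm_comm, lieForm_liftPlus_liftMinus, H.inner_g_h hx]
      field_simp
      ring
    · rw [lieForm_smul_left, hqm x hx, pMinus_eq, lieForm_sub_right, lieForm_smul_right,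
        lieForm_liftMinus_qMinus, lieForm_liftMinus_liftMinus, H.inner_h_h hx]
      ring
  have sE : ∀ {a : ℝ × ℝ → R31}, ContDiffOn ℝ ∞ a U →
      ContDiffOn ℝ ∞ (fun x => (M x (incl (a x))).2) U := fun ha =>
    sndL.contDiff.comp_contDiffOn (hM.smooth.clm_apply (inclL.contDiff.comp_contDiffOn ha))
  have fderiv_snd : ∀ {x : ℝ × ℝ}, x ∈ U → ∀ {y : ℝ × ℝ → R42} {y' : ℝ × ℝ →L[ℝ] R42},
      HasFDerivAt y y' x → ∀ (r : ℝ) (w : ℝ × ℝ), fderiv ℝ (fun x => r • (M x (y x)).2) x w =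
        r • (M x (deformationForm (curvSphere₁ f t φ) (curvSphere₂ f t φ) e₁ e₂ α β lam x w (y x)
          + y' w)).2 := by
    intro x hx y y' hy r w
    rw [← hM.hasFDerivAt_apply hU hx hy]
    have h1 := (sndL.hasFDerivAt.comp x
      ((hM.smooth.differentiableAt_of_isOpen hU hx).clm_apply
        hy.differentiableAt).hasFDerivAt).const_smul r
    exact congrArg (fun L => L w) (HasFDerivAt.fderiv h1)
  have g11 : ∀ x ∈ U, mink (M x (incl (e₁ x))).2 (M x (incl (e₁ x))).2 = 1 := fun x hx => by
    rw [← lieForm_incl, ← hE1 x hx, hM.isometry x hx, lieForm_incl, H.inner_e₁_e₁ hx]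
  have g12 : ∀ x ∈ U, mink (M x (incl (e₁ x))).2 (M x (incl (e₂ x))).2 = 0 := fun x hx => by
    rw [← lieForm_incl, ← hE1 x hx, ← hE2 x hx, hM.isometry x hx, lieForm_incl, H.inner_e₁_e₂ hx]
  have g22 : ∀ x ∈ U, mink (M x (incl (e₂ x))).2 (M x (incl (e₂ x))).2 = 1 := fun x hx => by
    rw [← lieForm_incl, ← hE2 x hx, hM.isometry x hx, lieForm_incl, H.inner_e₂_e₂ hx]
  have gg1 : ∀ x ∈ U, mink (g x) (M x (incl (e₁ x))).2 = 0 := fun x hx => by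
    rw [← lieForm_liftPlus_incl, ← hE1 x hx, ← hG x hx, lieForm_smul_left, hM.isometry x hx,
      lieForm_liftPlus_incl, mink_comm, H.inner_e₁_g hx, mul_zero]
  have gg2 : ∀ x ∈ U, mink (g x) (M x (incl (e₂ x))).2 = 0 := fun x hx => by
    rw [← lieForm_liftPlus_incl, ← hE2 x hx, ← hG x hx, lieForm_smul_left, hM.isometry x hx,
      lieForm_liftPlus_incl, mink_comm, H.inner_e₂_g hx, mul_zero]
  have gh1 : ∀ x ∈ U, mink (h x) (M x (incl (e₁ x))).2 = 0 := fun x hx => by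
    rw [← lieForm_liftMinus_incl, ← hE1 x hx, ← hH x hx, lieForm_smul_left, hM.isometry x hx,
      lieForm_liftMinus_incl, mink_comm, H.inner_e₁_h hx, mul_zero]
  have gh2 : ∀ x ∈ U, mink (h x) (M x (incl (e₂ x))).2 = 0 := fun x hx => by
    rw [← lieForm_liftMinus_incl, ← hE2 x hx, ← hH x hx, lieForm_smul_left, hM.isometry x hx,
      lieForm_liftMinus_incl, mink_comm, H.inner_e₂_h hx, mul_zero]
  have ggg : ∀ x ∈ U, mink (g x) (g x) = 0 := fun x hx => by
    rw [← lieForm_liftPlus_liftPlus, ← hG x hx, lieForm_smul_left, lieForm_smul_right,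
      hM.isometry x hx, lieForm_liftPlus_liftPlus, H.inner_g_g hx]
    ring
  have ghh : ∀ x ∈ U, mink (h x) (h x) = 0 := fun x hx => by
    rw [← lieForm_liftMinus_liftMinus, ← hH x hx, lieForm_smul_left, lieForm_smul_right,
      hM.isometry x hx, lieForm_liftMinus_liftMinus, H.inner_h_h hx]
    ring
  have ggh : ∀ x ∈ U, mink (g x) (h x) = 2 := fun x hx => by
    have h1 := lieForm_liftPlus_liftMinus g h x
    rw [← hG x hx, ← hH x hx, lieForm_smul_left, lieForm_smul_right,
      hM.isometry x hx, lieForm_liftPlus_liftMinus, H.inner_g_h hx] at h1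
    linarith
  refine ⟨fun x => (M x (incl (e₁ x))).2, fun x => (M x (incl (e₂ x))).2, g, h,
    ⟨sE H.smooth_e₁, sE H.smooth_e₂, ?_, ?_, ?_, ?_, ?_, ?_, H.α_ne, H.β_ne,
      fun x hx => mul_ne_zero hc (H.ξ_ne x hx), fun x hx => mul_ne_zero hd (H.η_ne x hx)⟩, ?_⟩
  · rw [hg]
    exact (sndL.contDiff.comp_contDiffOn (hM.smooth.clm_apply H.smooth_g.liftPlus)).const_smul c
  · rw [hh]
    exact (sndL.contDiff.comp_contDiffOn (hM.smooth.clm_apply H.smooth_h.liftMinus)).const_smul d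
  · intro x hx i j
    fin_cases i <;> fin_cases j <;>
      simp [frameGram, g11 x hx, g12 x hx, g22 x hx, gg1 x hx, gg2 x hx, gh1 x hx, gh2 x hx,
        ggg x hx, ghh x hx, ggh x hx, mink_comm _ (g x), mink_comm _ (h x),
        mink_comm (M x (incl (e₂ x))).2 (M x (incl (e₁ x))).2]
  · intro x hx w
    rw [hg, fderiv_snd hx (hasFDerivAt_liftPlus (H.smooth_g.differentiableAt_of_isOpen hU hx)),
      deformationForm_apply_liftPlus H hx, zero_add, ContinuousLinearMap.comp_apply,
      H.fderiv_g x hx]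
    simp only [map_add, map_smul, inclL_apply, Prod.snd_add, Prod.smul_snd]
    module
  · intro x hx w
    rw [hh, fderiv_snd hx (hasFDerivAt_liftMinus (H.smooth_h.differentiableAt_of_isOpen hU hx)),
      deformationForm_apply_liftMinus H hx, zero_add, ContinuousLinearMap.comp_apply,
      H.fderiv_h x hx]
    simp only [map_add, map_smul, inclL_apply, Prod.snd_add, Prod.smul_snd]
    module
  · intro x hx w
    have h1 : HasFDerivAt (fun x => incl (e₁ x)) (inclL.comp (fderiv ℝ e₁ x)) x :=
      inclL.hasFDerivAt.comp x (H.smooth_e₁.differentiableAt_of_isOpen hU hx).hasFDerivAt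
    have h2 := fderiv_snd hx h1 1 w
    simp only [one_smul] at h2
    have h3 : ∀ z : R42, mink z.2 (M x (incl (e₂ x))).2 = lieForm z (M x (incl (e₂ x))) := by
      intro z
      rw [hE2 x hx]
      simp [lieForm, incl]
    rw [h2, h3, hM.isometry x hx]
    -- The connection form sends `e₁` to a multiple of `s₂`, which is orthogonal to `e₂`, so the
    -- rotation form is unchanged.
    simp only [deformationForm, smul_apply, sub_apply, wedge_apply, lieForm_add_left,
      lieForm_smul_left, lieForm_sub_left, ContinuousLinearMap.comp_apply, inclL_apply,
      lieForm_incl, H.rotation x hx, H.inner_e₁_e₂ hx, H.inner_e₁_e₁ hx, H.inner_e₂_e₂ hx,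
      mink_comm (e₂ x) (e₁ x), curvSphere₁_eq, curvSphere₂_eq, lieForm_liftPlus_incl,
      lieForm_liftMinus_incl, mink_comm _ (e₁ x), mink_comm _ (e₂ x), H.inner_e₁_g hx,
      H.inner_e₁_h hx, H.inner_e₂_g hx, H.inner_e₂_h hx]
    ring
  · intro x hx
    have h1 : legendreLift f t x =
        Submodule.span ℝ {liftPlus (t + f) x, liftMinus (t - f) x} := by
      rw [← legendreLift_half]
      congr 1 <;> module
    rw [h1, Submodule.map_span, Set.image_pair, legendreLift_half, ← hG x hx, ← hH x hx]
    exact (span_pair_eq_of_det_ne_zero (x := c) (y := 0) (z := 0) (w := d) (by simp) (by simp)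
      (by simpa using ⟨hc, hd⟩)).symm

end DeformedFront

/-! ## Normalization of the constants of integration -/

/-- The reflection in the hyperplane orthogonal to `n`. -/
noncomputable def lieReflection (n : R42) : R42 →L[ℝ] R42 :=
  ContinuousLinearMap.id ℝ R42 - (2 / lieForm n n) • (lieDual n).smulRight n

theorem lieReflection_apply (n y : R42) :
    lieReflection n y = y - (2 / lieForm n n * lieForm n y) • n := by
  rw [mul_smul]
  rfl

theorem isLieIsometry_lieReflection {n : R42} (hn : lieForm n n ≠ 0) :
    IsLieIsometry (lieReflection n) := by
  intro x y
  simp only [lieReflection_apply, lieForm_sub_left, lieForm_sub_right, lieForm_smul_left,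
    lieForm_smul_right, lieForm_comm x n]
  field_simp
  ring

theorem lieReflection_of_orthogonal {n y : R42} (h : lieForm n y = 0) :
    lieReflection n y = y := by
  rw [lieReflection_apply, h]
  simp

theorem lieReflection_sub {x y : R42} (h : lieForm x x = lieForm y y)
    (hn : lieForm (x - y) (x - y) ≠ 0) : lieReflection (x - y) x = y := by
  have h1 : 2 / lieForm (x - y) (x - y) * lieForm (x - y) x = 1 := by
    rw [div_mul_eq_mul_div, div_eq_one_iff_eq hn]
    simp only [lieForm_sub_left, lieForm_sub_right, lieForm_comm y x]
    linarith
  rw [lieReflection_apply, h1]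
  module

/-- Vectors of the same nonzero norm are related by an isometry that fixes any given vector
orthogonal to both of them. -/
theorem exists_isLieIsometry_apply_eq {x y : R42} (h : lieForm x x = lieForm y y)
    (hy : lieForm y y ≠ 0) :
    ∃ A, IsLieIsometry A ∧ A x = y ∧ ∀ z, lieForm x z = 0 → lieForm y z = 0 → A z = z := by
  by_cases hn : lieForm (x - y) (x - y) = 0
  -- By the parallelogram law the norms of `x - y` and `x + y` add up to `4 (y, y) ≠ 0`. If the
  -- first vanishes, reflect `x` to `-y` instead and then reflect in `y`.
  · have hn' : lieForm (x - -y) (x - -y) ≠ 0 := by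
      intro h0
      rw [sub_neg_eq_add] at h0
      simp only [lieForm_sub_left, lieForm_sub_right, lieForm_add_left, lieForm_add_right] at hn h0
      apply hy
      linarith
    have hnn : lieForm (-y) (-y) = lieForm y y := by
      rw [lieForm_neg_right, lieForm_comm, lieForm_neg_right, neg_neg]
    refine ⟨(lieReflection y).comp (lieReflection (x - -y)),
      (isLieIsometry_lieReflection hy).comp (isLieIsometry_lieReflection hn'), ?_, ?_⟩
    · rw [ContinuousLinearMap.comp_apply, lieReflection_sub (h.trans hnn.symm) hn',
        lieReflection_apply, lieForm_neg_right]
      match_scalars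
      field_simp
      ring
    · intro z hx hyz
      rw [ContinuousLinearMap.comp_apply, lieReflection_of_orthogonal (n := x - -y),
        lieReflection_of_orthogonal hyz]
      rw [sub_neg_eq_add, lieForm_add_left, hx, hyz, add_zero]
  · exact ⟨_, isLieIsometry_lieReflection hn, lieReflection_sub h hn, fun z hx hyz =>
      lieReflection_of_orthogonal (by rw [lieForm_sub_left, hx, hyz, sub_zero])⟩

/-- A pair of null vectors with nonzero product `-2k` can be mapped to `q⁺` and `k q⁻`. -/
theorem exists_isLieIsometry_null_pair {P Q : R42} {k : ℝ} (hk : k ≠ 0) (hPP : lieForm P P = 0)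
    (hQQ : lieForm Q Q = 0) (hPQ : lieForm P Q = -2 * k) :
    ∃ A, IsLieIsometry A ∧ A P = qPlus ∧ A Q = k • qMinus := by
  have hpp : lieForm pVec pVec = -1 := by simp [lieForm, pVec, mink]
  have hqq : lieForm qVec qVec = 1 := by simp [lieForm, qVec, mink]
  have hpq : lieForm qVec pVec = 0 := by simp [lieForm, pVec, qVec, mink]
  -- `P / 2 ± Q / (2k)` are orthogonal of norms `∓1`. One isometry moves the first to `𝔭`, and a
  -- second, fixing `𝔭`, moves the image of the other to `𝔮`.
  obtain ⟨A, hA, hAx, -⟩ := exists_isLieIsometry_apply_eq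
    (x := (1 / 2 : ℝ) • P + (1 / (2 * k)) • Q) (y := pVec)
    (by simp only [lieForm_add_left, lieForm_add_right, lieForm_smul_left, lieForm_smul_right,
          hPP, hQQ, hPQ, lieForm_comm Q P, hpp]
        field_simp
        ring) (by rw [hpp]; norm_num)
  obtain ⟨B, hB, hBx, hBf⟩ := exists_isLieIsometry_apply_eq
    (x := A ((1 / 2 : ℝ) • P - (1 / (2 * k)) • Q)) (y := qVec)
    (by rw [hA, hqq]
        simp only [lieForm_sub_left, lieForm_sub_right, lieForm_smul_left, lieForm_smul_right,
          hPP, hQQ, hPQ, lieForm_comm Q P]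
        field_simp
        ring) (by rw [hqq]; norm_num)
  have hBp : B pVec = pVec := by
    refine hBf _ ?_ hpq
    rw [← hAx, hA]
    simp only [lieForm_sub_left, lieForm_add_right, lieForm_smul_left, lieForm_smul_right,
      hPP, hQQ, hPQ, lieForm_comm Q P]
    ring
  refine ⟨B.comp A, hB.comp hA, ?_, ?_⟩
  · have h1 : P = ((1 / 2 : ℝ) • P + (1 / (2 * k)) • Q) + ((1 / 2 : ℝ) • P - (1 / (2 * k)) • Q) := by
      module
    rw [ContinuousLinearMap.comp_apply, h1, map_add, map_add, hAx, hBx, hBp, qPlus]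
  · have h1 : Q = k • (((1 / 2 : ℝ) • P + (1 / (2 * k)) • Q) -
        ((1 / 2 : ℝ) • P - (1 / (2 * k)) • Q)) := by
      match_scalars <;> field_simp <;> ring
    rw [ContinuousLinearMap.comp_apply]
    conv_lhs => rw [h1]
    rw [map_smul, map_smul, map_sub, map_sub, hAx, hBx, hBp, qMinus]

/-- The isometry `-1` on `ℝ^{3,1}`. -/
noncomputable def spaceInversion : R42 →L[ℝ] R42 :=
  (ContinuousLinearMap.id ℝ (ℝ × ℝ)).prodMap (-ContinuousLinearMap.id ℝ R31)

theorem isLieIsometry_spaceInversion : IsLieIsometry spaceInversion := fun x y => by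
  simp [spaceInversion, lieForm, mink]

theorem spaceInversion_qPlus : spaceInversion qPlus = qPlus := by
  simp [spaceInversion, qPlus, pVec, qVec]

theorem spaceInversion_qMinus : spaceInversion qMinus = qMinus := by
  simp [spaceInversion, qMinus, pVec, qVec]

theorem MapsFront.spaceInversion {U : Set (ℝ × ℝ)} {T : ℝ × ℝ → R42 →L[ℝ] R42}
    {f t f' t' : ℝ × ℝ → R31} (h : MapsFront U T f t f' t') :
    MapsFront U (fun x => spaceInversion.comp (T x)) f t (-f') (-t') := by
  intro x hx
  change (legendreLift f t x).map (_root_.spaceInversion.toLinearMap ∘ₗ (T x).toLinearMap) = _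
  rw [Submodule.map_comp, h x hx, legendreLift, legendreLift, Submodule.map_span, Set.image_pair]
  simp [_root_.spaceInversion, qVec, pVec, incl]

/-- On a connected set, one of `±f` lies on the upper sheet of the hyperboloid. -/
theorem pos_or_neg_of_norm {U : Set (ℝ × ℝ)} (hUc : IsPreconnected U) {f : ℝ × ℝ → R31}
    (hf : ContinuousOn f U) (hn : ∀ x ∈ U, mink (f x) (f x) = -1) :
    (∀ x ∈ U, 0 < f x 0) ∨ ∀ x ∈ U, 0 < (-f) x 0 := by
  have h0 : ∀ x ∈ U, f x 0 ≠ 0 := by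
    intro x hx h
    have := hn x hx
    simp only [mink, h] at this
    nlinarith [sq_nonneg (f x 1), sq_nonneg (f x 2), sq_nonneg (f x 3)]
  have hc : ContinuousOn (fun x => f x 0) U := fun x hx => (continuousWithinAt_pi.1 (hf x hx)) 0
  by_contra! hcon
  obtain ⟨⟨x, hx, hx0⟩, y, hy, hy0⟩ := hcon
  simp only [Pi.neg_apply, Left.neg_nonpos_iff] at hy0
  obtain ⟨z, hz, hz0⟩ := hUc.intermediate_value hx hy hc ⟨hx0, hy0⟩
  exact h0 z hz hz0

/-- The properties of the deformed surface for normalized constants of integration. -/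
theorem exists_deformed_front {U : Set (ℝ × ℝ)} (hU : IsOpen U) (hUc : IsConnected U)
    {f t e₁ e₂ : ℝ × ℝ → R31} {φ α β : ℝ × ℝ → ℝ} {θ : ℝ × ℝ → ℝ × ℝ → ℝ}
    (H : IsNullFrame U e₁ e₂ (t + f) (t - f) α β (fun x => Real.exp (-φ x))
      (fun x => Real.exp (φ x)) θ) {lam : ℝ} (hlam : lam ≠ 1 / 2)
    {M : ℝ × ℝ → R42 →L[ℝ] R42}
    (hM : IsDeformation U (curvSphere₁ f t φ) (curvSphere₂ f t φ) e₁ e₂ α β lam M)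
    (hN : IsNormalized U (curvSphere₁ f t φ) (curvSphere₂ f t φ) lam M) :
    ∃ f' t' : ℝ × ℝ → R31, MapsFront U M f t f' t' ∧
      (IsFlatFront U f' t' ∨ IsFlatFront U (-f') (-t')) ∧
      IsCurvedFlat U (gaussPair f' t') ∧
      (∀ μ : ℂ, μ ^ 2 = 1 - 2 * (lam : ℂ) →
        IsAssociatedCurvedFlat ℂ U μ (gaussPair f t) (gaussPair f' t')) ∧
      (∀ μ : ℝ, μ ^ 2 = 1 - 2 * lam →
        IsAssociatedCurvedFlat ℝ U μ (gaussPair f t) (gaussPair f' t')) := by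
  obtain ⟨x₀, hx₀⟩ := hUc.nonempty
  obtain ⟨P, hP⟩ := hM.exists_apply_pPlus_eq hU hUc.isPreconnected H
  obtain ⟨Q, hQ⟩ := hM.exists_apply_pMinus_eq hU hUc.isPreconnected H
  obtain ⟨h1, h2⟩ := hN x₀ hx₀
  rw [hP x₀ hx₀] at h1
  rw [hQ x₀ hx₀] at h2
  obtain ⟨d, rfl⟩ := Submodule.mem_span_singleton.1 h1
  obtain ⟨c, rfl⟩ := Submodule.mem_span_singleton.1 h2
  -- Compare `(p⁺, p⁻) = -2 (1 - 2λ)` with `(d q⁺, c q⁻) = -2 c d`.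
  have hcd : c * d = 1 - 2 * lam := by
    have h3 := lieForm_pPlus_pMinus H lam hx₀
    rw [← hM.isometry x₀ hx₀, hP x₀ hx₀, hQ x₀ hx₀, lieForm_smul_left, lieForm_smul_right,
      lieForm_qPlus_qMinus] at h3
    linarith
  have hcd0 : c * d ≠ 0 := fun h => hlam (by linarith)
  obtain ⟨e₁', e₂', g, h, H', hmap⟩ := hM.exists_isNullFrame hU H hcd0 hP hQ
  have hpair : gaussPair ((1 / 2 : ℝ) • (g - h)) ((1 / 2 : ℝ) • (g + h)) =
      fun x => (Submodule.span ℝ {g x}, Submodule.span ℝ {h x}) := by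
    funext x
    simp only [gaussPair, Pi.smul_apply, Pi.add_apply, Pi.sub_apply]
    congr 3 <;> module
  have hass : ∀ {𝕜 : Type} [RCLike 𝕜] {μ : 𝕜}, μ ^ 2 = algebraMap ℝ 𝕜 (c * d) →
      IsAssociatedCurvedFlat 𝕜 U μ (gaussPair f t)
        (fun x => (Submodule.span ℝ {g x}, Submodule.span ℝ {h x})) := fun hμ =>
    H.isAssociatedCurvedFlat H' hU (fun _ _ => rfl) (fun _ _ => rfl) hcd0 hμ
  refine ⟨_, _, hmap, ?_, ?_, fun μ hμ => ?_, fun μ hμ => ?_⟩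
  · rcases pos_or_neg_of_norm hUc.isPreconnected
      (contDiffOn_const.smul (H'.smooth_g.sub H'.smooth_h)).continuousOn
      (fun x hx => H'.norm_half_sub hx) with hpos | hneg
    · exact Or.inl (H'.isFlatFront hU hpos)
    · have e1 : -((1 / 2 : ℝ) • (g - h)) = (1 / 2 : ℝ) • (-g - -h) := by module
      have e2 : -((1 / 2 : ℝ) • (g + h)) = (1 / 2 : ℝ) • (-g + -h) := by module
      rw [e1, e2]
      exact Or.inr (H'.neg.isFlatFront hU (by rwa [← e1]))
  · rw [hpair]
    exact H'.isCurvedFlat hU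
  · rw [hpair]
    exact hass (by rw [hμ, hcd]; simp)
  · rw [hpair]
    exact hass (by rw [hμ, hcd]; simp)

/-! ### The main theorem -/

theorem mainTheorem3 (U : Set (ℝ × ℝ)) (hU : IsOpen U) (hUc : IsConnected U)
    (f t : ℝ × ℝ → R31) (φ : ℝ × ℝ → ℝ)
    (hf : IsFlatFront U f t) (hφ : IsCurvatureLineParam U f t φ) :
    IsOmegaSurface U (legendreLift f t) (curvSphere₁ f t φ) (curvSphere₂ f t φ) ∧
    IsCurvedFlat U (gaussPair f t) ∧
    ∀ lam : ℝ, lam ≠ 1 / 2 → ∀ T : ℝ × ℝ → R42 →L[ℝ] R42,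
      IsLieDeformation U (curvSphere₁ f t φ) (curvSphere₂ f t φ) lam T →
      (∃ A : R42 →L[ℝ] R42, IsLieIsometry A ∧
        IsNormalized U (curvSphere₁ f t φ) (curvSphere₂ f t φ) lam (fun x => A.comp (T x)) ∧
        ∃ f' t' : ℝ × ℝ → R31, IsFlatFront U f' t' ∧
          MapsFront U (fun x => A.comp (T x)) f t f' t') ∧
      ∀ A : R42 →L[ℝ] R42, IsLieIsometry A →
        IsNormalized U (curvSphere₁ f t φ) (curvSphere₂ f t φ) lam (fun x => A.comp (T x)) →
        ∃ f' t' : ℝ × ℝ → R31,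
          MapsFront U (fun x => A.comp (T x)) f t f' t' ∧
          (IsFlatFront U f' t' ∨ IsFlatFront U (-f') (-t')) ∧
          IsCurvedFlat U (gaussPair f' t') ∧
          (∀ μ : ℂ, μ ^ 2 = 1 - 2 * (lam : ℂ) →
            IsAssociatedCurvedFlat ℂ U μ (gaussPair f t) (gaussPair f' t')) ∧
          (∀ μ : ℝ, μ ^ 2 = 1 - 2 * lam →
            IsAssociatedCurvedFlat ℝ U μ (gaussPair f t) (gaussPair f' t')) := by
  obtain ⟨e₁, e₂, α, β, θ, H⟩ := hf.exists_isNullFrame hU hφ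
  refine ⟨isOmegaSurface_of_isNullFrame hU hf.smooth_f hf.smooth_t hφ.smooth H,
    H.isCurvedFlat hU, fun lam hlam T hT => ?_⟩
  have hD := isDeformation_of_isLieDeformation hU hf.smooth_f hf.smooth_t hφ.smooth H hT
  refine ⟨?_, fun A hA hN => exists_deformed_front hU hUc H hlam (hD.postcomp hU hA) hN⟩
  obtain ⟨x₀, hx₀⟩ := hUc.nonempty
  obtain ⟨P, hP⟩ := hD.exists_apply_pPlus_eq hU hUc.isPreconnected H
  obtain ⟨Q, hQ⟩ := hD.exists_apply_pMinus_eq hU hUc.isPreconnected H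
  obtain ⟨A, hA, hAP, hAQ⟩ := exists_isLieIsometry_null_pair (P := P) (Q := Q) (k := 1 - 2 * lam)
    (fun h => hlam (by linarith))
    (by rw [← hP x₀ hx₀, hD.isometry x₀ hx₀, lieForm_pPlus_pPlus H lam hx₀])
    (by rw [← hQ x₀ hx₀, hD.isometry x₀ hx₀, lieForm_pMinus_pMinus H lam hx₀])
    (by rw [← hP x₀ hx₀, ← hQ x₀ hx₀, hD.isometry x₀ hx₀, lieForm_pPlus_pMinus H lam hx₀])
  have hN : IsNormalized U (curvSphere₁ f t φ) (curvSphere₂ f t φ) lam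
      (fun x => A.comp (T x)) := fun x hx => by
    simp only [ContinuousLinearMap.comp_apply, hP x hx, hQ x hx, hAP, hAQ]
    exact ⟨Submodule.mem_span_singleton_self _, Submodule.mem_span_singleton.2 ⟨_, rfl⟩⟩
  obtain ⟨f', t', hmap, hflat | hflat, -⟩ :=
    exists_deformed_front hU hUc H hlam (hD.postcomp hU hA) hN
  · exact ⟨A, hA, hN, f', t', hflat, hmap⟩
  -- The surface landed on the lower sheet; `-1` on `ℝ^{3,1}` corrects this and fixes `q^±`, so the
  -- normalization survives.
  · refine ⟨spaceInversion.comp A, isLieIsometry_spaceInversion.comp hA, fun x hx => ?_, -f', -t',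
      hflat, hmap.spaceInversion⟩
    simp only [ContinuousLinearMap.comp_apply, hP x hx, hQ x hx, hAP, hAQ, map_smul,
      spaceInversion_qPlus, spaceInversion_qMinus]
    exact ⟨Submodule.mem_span_singleton_self _, Submodule.mem_span_singleton.2 ⟨_, rfl⟩⟩
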